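/- Let $d,s\ge 0$ be integers, $(a_{ij})_{i,j=1}^s$, $(b_i)_{i=1}^s$ real Runge–Kutta coefficients, and $R>0$, $M\in\mathbb R$, $0<\epsilon<\tfrac12$, $k>0$. Put $$\kappa=\max_i\sum_j|a_{ij}|,\quad \mu=\sum_i|b_i|,\quad \eta=2\max\Big\{\kappa,\frac{\mu}{2\ln 2-1}\Big\},\quad h_0=\frac{R}{\eta M(d+1)^2\sqrt s}$$ (with $\kappa:=0$ if $s=0$, and $h_0:=0$ if the denominator is $0$, in which case the problem is trivial). Let $m\ge0$, $z\in\mathbb C^m$ (for example $z\in\mathbb R^m$), and let $V_0,\dots,V_d$ be $\mathbb C^m$-valued maps that are analytic on a neighbourhood of the closed ball $B_{2R}(z)=\{y\in\mathbb C^m:\|y-z\|\le 2R\}$ and satisfy $\|V_l(y)\|\le M$ for $y\in B_{2R}(z)$, where $\|\cdot\|$ is the Euclidean norm. Let $\xi_1,\dots,\xi_d$ be independent standard normal random variables (representing the Brownian increments $X^l_{0,h}=\sqrt h\,\xi_l$). For a step size $h>0$ let $A_h=\sqrt{k|\ln h|}$, let $\zeta_l$ be $\xi_l$ truncated to $[-A_h,A_h]$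 (that is, $\zeta_l=\xi_l$ if $|\xi_l|\le A_h$, $\zeta_l=A_h$ if $\xi_l>A_h$, $\zeta_l=-A_h$ if $\xi_l<-A_h$), and let $\Delta_l=\zeta_l\sqrt h$. For $y$ in the interior of $B_{2R}(z)$ and small increments $x=(x_0,\dots,x_d)$, the Runge–Kutta step from $y$ is $$Y_i=y+\sum_{j=1}^s a_{ij}\sum_{l=0}^d V_l(Y_j)\,x_l\quad(i=1,\dots,s),\qquad \Phi(y;x)=y+\sum_{i=1}^s b_i\sum_{l=0}^d V_l(Y_i)\,x_l,$$ with stages $Y_i\in B_{2R}(z)$. Let $d_\alpha(y)$, $\alpha\in\mathbb N^{d+1}$, be the coefficients of its expansion $\Phi(y;x)=y+\sum_{|\alpha|\ge1}d_\alpha(y)x^\alpha$ at $x=0$. Define $f_\alpha$, $|\alpha|\ge 1$, recursively by $$f_\alpha=d_\alpha-\sum_{i=2}^{|\alpha|}\frac1{i!}\sum_{\substack{k^1+\dots+k^i=\alpha\\ |k^j|\ge1}}D_{k^1}\cdots D_{k^{i-1}}f_{k^i},\qquad (D_kg)(y)=g'(y)f_k(y),$$ so that $f_\alpha=d_\alpha$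 for $|\alpha|=1$. For $\tilde N\ge1$ the $\tilde N$-truncated modified equation on the first step is $$\dot{\tilde y}^{\tilde N}_t=\sum_{1\le|\alpha|\le\tilde N}f_\alpha(\tilde y^{\tilde N}_t)\,h^{\alpha_0-1}\Delta_1^{\alpha_1}\cdots\Delta_d^{\alpha_d},\quad t\in[0,h],\qquad \tilde y^{\tilde N}_0=z.$$ Then there are constants $C>0$ and $h_{\max}>0$, depending only on $d,s,(a_{ij}),(b_i),R,M,\epsilon,k$, such that for every $0<h<h_{\max}$ there is an integer $\tilde N=\tilde N(h)\ge1$, depending only on $h$ and the same data, for which the following holds for all $m$, $z$, $V_0,\dots,V_d$, $\xi_1,\dots,\xi_d$ as above and every outcome $\omega$: the Runge–Kutta step from $z$ with increments $(h,\Delta_1,\dots,\Delta_d)$ has exactly one vector of stages in $B_{2R}(z)$, the $\tilde N$-truncated modified equation has exactly one solution on $[0,h]$, and with $Y^h_1=\Phi(z;h,\Delta_1,\dots,\Delta_d)$ and $t_1=h$, $$\|\tilde y^{\tilde N}_{t_1}-Y^h_1\|\le C\,h\,\exp\!\big(-h_0/h^{\frac12-\epsilon}\big).$$ -/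

import Mathlib

open Set Finset MeasureTheory ProbabilityTheory
open scoped Nat

noncomputable section

namespace StochModEq

variable {E : Type*} [NormedAddCommGroup E] [NormedSpace ℂ E]

/-- The length `|α| = α₀ + ⋯ + α_{n-1}` of a multi-index. -/
def deg {n : ℕ} (α : Fin n → ℕ) : ℕ := ∑ l, α l

/-- The coefficient of `x ^ α` in the Taylor expansion of `F` at `0`, that is
`(∂^α F)(0) / α!`. It is written as the coefficient of `x ^ α` in the homogeneous term
`(1 / |α|!) D^{|α|}F(0)(x, …, x)`: the sum is over all words `σ` in which each letter `l`
occurs exactly `α l` times. -/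
def taylorCoeff {n : ℕ} (F : (Fin n → ℂ) → E) (α : Fin n → ℕ) : E :=
  ((deg α)! : ℂ)⁻¹ •
    ∑ σ : Fin (deg α) → Fin n with ∀ l, #{i | σ i = l} = α l,
      iteratedFDeriv ℂ (deg α) F 0 (fun i => Pi.single (σ i) 1)

/-- `g` is a vector of stages, with values in the domain `S` of the vector fields, of the
Runge–Kutta step from `y` with increments `x = (h, Δ₁, …, Δ_d)`. -/
def IsRKStages {n s : ℕ} (a : Fin s → Fin s → ℝ) (V : Fin n → E → E) (S : Set E)
    (x : Fin n → ℂ) (y : E) (g : Fin s → E) : Prop :=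
  ∀ i, g i ∈ S ∧ g i = y + ∑ j, (a i j : ℂ) • ∑ l, x l • V l (g j)

/-- The stages of the Runge–Kutta step; meaningful where they exist and are unique. -/
def rkStages {n s : ℕ} (a : Fin s → Fin s → ℝ) (V : Fin n → E → E) (S : Set E)
    (x : Fin n → ℂ) (y : E) : Fin s → E :=
  Classical.epsilon (IsRKStages a V S x y)

/-- One step of the Runge–Kutta method with increments `x`, started at `y`. -/
def rkStep {n s : ℕ} (a : Fin s → Fin s → ℝ) (b : Fin s → ℝ) (V : Fin n → E → E) (S : Set E)
    (x : Fin n → ℂ) (y : E) : E :=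
  y + ∑ i, (b i : ℂ) • ∑ l, x l • V l (rkStages a V S x y i)

/-- The coefficients `d_α` in the expansion
`Y₁(y) = y + ∑_{|α| ≥ 1} d_α(y) h^{α₀} Δ₁^{α₁} ⋯ Δ_d^{α_d}` of the Runge–Kutta step. -/
def rkCoeff {n s : ℕ} (a : Fin s → Fin s → ℝ) (b : Fin s → ℝ) (V : Fin n → E → E) (S : Set E)
    (α : Fin n → ℕ) (y : E) : E :=
  taylorCoeff (fun x => rkStep a b V S x y) α

/-- `iterD [f₁, …, fᵢ] = D_{f₁} ⋯ D_{f_{i-1}} fᵢ`, where `(D_f g)(y) = g'(y) f(y)`. -/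
def iterD : List (E → E) → E → E
  | [] => 0
  | [f] => f
  | f :: g :: L => fun y => fderiv ℂ (iterD (g :: L)) y (f y)

/-- The index set `O_i`: all `(k¹, …, kⁱ)` of multi-indices of length at least one
with `k¹ + ⋯ + kⁱ = α`. -/
def splittings {n : ℕ} (i : ℕ) (α : Fin n → ℕ) : Finset (Fin i → Fin n → ℕ) :=
  {k ∈ Fintype.piFinset fun _ => Finset.Iic α | (∀ j, 1 ≤ deg (k j)) ∧ ∑ j, k j = α}

theorem mem_splittings {n i : ℕ} {α : Fin n → ℕ} {k : Fin i → Fin n → ℕ} :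
    k ∈ splittings i α ↔ (∀ j, 1 ≤ deg (k j)) ∧ ∑ j, k j = α := by
  simp only [splittings, Finset.mem_filter, Fintype.mem_piFinset, Finset.mem_Iic,
    and_iff_right_iff_imp]
  rintro ⟨-, rfl⟩ j
  exact Finset.single_le_sum (f := k) (fun _ _ => zero_le) (Finset.mem_univ j)

theorem deg_lt_of_mem_splittings {n i : ℕ} (hi : 2 ≤ i) {α : Fin n → ℕ}
    {k : Fin i → Fin n → ℕ} (hk : k ∈ splittings i α) (j : Fin i) : deg (k j) < deg α := by
  obtain ⟨h1, rfl⟩ := mem_splittings.1 hk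
  have hs : deg (∑ j, k j) = ∑ j, deg (k j) := by
    simp only [deg, Finset.sum_apply]
    exact Finset.sum_comm
  rw [hs]
  have : Nontrivial (Fin i) := Fin.nontrivial_iff_two_le.2 hi
  obtain ⟨j', hj'⟩ := exists_ne j
  exact Finset.single_lt_sum (f := fun j => deg (k j)) hj' (Finset.mem_univ j) (Finset.mem_univ j')
    (h1 j') (fun _ _ _ => Nat.zero_le _)

/-- The coefficients `f_α` of the modified equation belonging to the expansion coefficients
`c = (d_α)`, by recursion on `|α|`:
`f_α = d_α - ∑_{i=2}^{|α|} (1/i!) ∑_{(k¹,…,kⁱ) ∈ O_i} D_{k¹} ⋯ D_{k^{i-1}} f_{kⁱ}`,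
where `D_k g = g' f_k`. -/
def modCoeff {n : ℕ} (c : (Fin n → ℕ) → E → E) (α : Fin n → ℕ) : E → E := fun y =>
  c α y - ∑ i : Finset.Icc 2 (deg α), ((i.1)! : ℂ)⁻¹ •
    ∑ k : splittings i.1 α, iterD (List.ofFn fun j => modCoeff c (k.1 j)) y
termination_by deg α
decreasing_by exact deg_lt_of_mem_splittings (Finset.mem_Icc.1 i.2).1 k.2 j

theorem modCoeff_eq {n : ℕ} (c : (Fin n → ℕ) → E → E) (α : Fin n → ℕ) (y : E) :
    modCoeff c α y = c α y - ∑ i ∈ Finset.Icc 2 (deg α), (i ! : ℂ)⁻¹ •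
      ∑ k ∈ splittings i α, iterD (List.ofFn fun j => modCoeff c (k j)) y := by
  rw [modCoeff, ← Finset.sum_coe_sort (Finset.Icc 2 (deg α))]
  congr 1
  refine Finset.sum_congr rfl fun i _ => ?_
  rw [← Finset.sum_coe_sort (splittings i.1 α)]

/-- The multi-indices `α` with `1 ≤ |α| ≤ N`. -/
def indexSet (n N : ℕ) : Finset (Fin n → ℕ) :=
  {α ∈ Fintype.piFinset fun _ => Finset.range (N + 1) | 1 ≤ deg α ∧ deg α ≤ N}

/-- The right-hand side
`∑_{1 ≤ |α| ≤ N} f_α(y) h^{α₀ - 1} Δ₁^{α₁} ⋯ Δ_d^{α_d}` of the `N`-truncated modified equation. -/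
def truncField {d : ℕ} (f : (Fin (d + 1) → ℕ) → E → E) (N : ℕ) (h : ℝ) (Δ : Fin d → ℝ)
    (y : E) : E :=
  ∑ α ∈ indexSet (d + 1) N,
    ((h ^ ((α 0 : ℤ) - 1) * ∏ l : Fin d, Δ l ^ α l.succ : ℝ) : ℂ) • f α y

/-- The vector `x = (h, Δ₁, …, Δ_d)` of all increments over one step, with complex entries. -/
def incrVec {d : ℕ} (h : ℝ) (Δ : Fin d → ℝ) : Fin (d + 1) → ℂ :=
  Fin.cons (h : ℂ) fun l => (Δ l : ℂ)

/-- `u` solves `u' = F(u)` on `[0, h]` with `u(0) = z`. -/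
def IsSolution [NormedSpace ℝ E] (F : E → E) (h : ℝ) (z : E) (u : ℝ → E) : Prop :=
  u 0 = z ∧ ∀ t ∈ Set.Icc 0 h, HasDerivWithinAt u (F (u t)) (Set.Icc 0 h) t

/-- The threshold `A_h = √(k |ln h|)`. -/
def threshold (k h : ℝ) : ℝ := √(k * |Real.log h|)

/-- The truncation of `ξ` to `[-A, A]`. -/
def truncate (A ξ : ℝ) : ℝ := if |ξ| ≤ A then ξ else if A < ξ then A else -A

/-- The truncated increment `ζ √h`, where `ζ` is `ξ` truncated at `±A_h`. -/
def truncIncrement (k h ξ : ℝ) : ℝ := truncate (threshold k h) ξ * √h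

/-- The truncated increments `Δ_{1,l}`, `l = 1, …, d`, of the first step, at the outcome `ω`. -/
def truncIncrements {d : ℕ} {Ω : Type*} (k h : ℝ) (ξ : Fin d → Ω → ℝ) (ω : Ω) : Fin d → ℝ :=
  fun l => truncIncrement k h (ξ l ω)

/-- `u` solves, on `[0, h]` and with `u(0) = z`, the `N`-truncated modified equation of the
Runge–Kutta method with increments `h, Δ₁, …, Δ_d`. -/
def IsTruncModSolution [NormedSpace ℝ E] {d s : ℕ} (a : Fin s → Fin s → ℝ) (b : Fin s → ℝ)
    (V : Fin (d + 1) → E → E) (S : Set E) (N : ℕ) (h : ℝ) (Δ : Fin d → ℝ) (z : E)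
    (u : ℝ → E) : Prop :=
  IsSolution (truncField (modCoeff (rkCoeff a b V S)) N h Δ) h z u

/-- The constant `η = 2 max {κ, μ / (2 ln 2 - 1)}`, with `κ = max_i ∑_j |a_ij|` and
`μ = ∑_i |b_i|`. -/
def eta {s : ℕ} (a : Fin s → Fin s → ℝ) (b : Fin s → ℝ) : ℝ :=
  2 * max (⨆ i, ∑ j, |a i j|) ((∑ i, |b i|) / (2 * Real.log 2 - 1))

/-- The constant `h₀ = R / (η M (d+1)² √s)`. -/
def hZero {s : ℕ} (d : ℕ) (a : Fin s → Fin s → ℝ) (b : Fin s → ℝ) (R M : ℝ) : ℝ :=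
  R / (eta a b * M * ((d : ℝ) + 1) ^ 2 * √(s : ℝ))

end StochModEq

end

/-! The recursion behind `modCoeff` says that, formally, the Lie series `∑ (1/i!) D_F^i` of the
modified field reproduces the Taylor series of the method in its increments. No convergence of the
modified series is claimed. It is truncated at degree `N`, and `N` grows as the increments shrink.

Let `ρ` bound the increments. By Cauchy's estimate a Lie derivative costs a factor `1/σ` and a shell
of width `σ`; with `σ = R/(2N)`, `N` of them use up only `R/2`. As long as `ρ N` stays below a
constant, a majorant recursion (`norm_modCoeff_le`, `sum_majCoeff_le`) bounds the sum of `(e ρ)^|α|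
‖f_α‖` by `σ/2`. Since the weight is `e ρ` and not `ρ`, every contribution of degree above `N` gains
a factor `e^{-(N+1)}`.

Three errors then separate the flow from the method: the Taylor remainder of the flow in time
(`IsSolution.norm_sub_lieSeries_le`), the part of the Lie series of degree above `N`
(`norm_lieSeries_sub_le`), and the Taylor remainder of the method in the increments
(`norm_sub_sum_taylorCoeff_le`). Each is `O(e^{-(N+1)})`, and `exists_unitField_isSolution` adds
them up.

For Runge–Kutta methods the stages come from a contraction and are analytic in increments and
starting point by the implicit function theorem, so the method is a bounded holomorphic map near
zero increments. Truncation makes all increments at most `ρ = h^{1/2-ε/2}`, for each outcome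
separately. With `N ≈ c/ρ` the error is `O(e^{-c/ρ})`; the spare power `h^{ε/2}` in the exponent
pays both for the factor `h` and for whatever value `h₀` has. -/

namespace StochModEq

/-! ### Cauchy's estimate for the first derivative -/

section Cauchy

variable {E F : Type*} [NormedAddCommGroup E] [NormedSpace ℂ E]
  [NormedAddCommGroup F] [NormedSpace ℂ F]

/-- Cauchy's estimate for the Fréchet derivative of a bounded holomorphic map on a ball. -/
theorem norm_fderiv_le_div_of_ball {g : E → F} {y : E} {σ C : ℝ} (hσ : 0 < σ)
    (hd : DifferentiableOn ℂ g (Metric.ball y σ)) (hC : ∀ w ∈ Metric.ball y σ, ‖g w‖ ≤ C) :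
    ‖fderiv ℂ g y‖ ≤ C / σ := by
  have hC0 : 0 ≤ C := (norm_nonneg _).trans (hC y (Metric.mem_ball_self hσ))
  refine ContinuousLinearMap.opNorm_le_bound _ (by positivity) fun v => ?_
  rcases eq_or_ne v 0 with rfl | hv
  · simp
  have hv' : 0 < ‖v‖ := norm_pos_iff.2 hv
  -- Holomorphy is known on the open ball only, so the one-variable estimate is applied on smaller
  -- closed discs in the direction `v`; `ρ` tends to `σ` afterwards.
  have key : ∀ ρ, 0 < ρ → ρ < σ → ‖fderiv ℂ g y v‖ * ρ ≤ C * ‖v‖ := by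
    intro ρ hρ hρσ
    have hmem : ∀ t : ℂ, ‖t‖ ≤ ρ / ‖v‖ → y + t • v ∈ Metric.ball y σ := by
      intro t ht
      rw [mem_ball_iff_norm, add_sub_cancel_left, norm_smul]
      exact ((le_div_iff₀ hv').1 ht).trans_lt hρσ
    have hdiff : ∀ t : ℂ, ‖t‖ ≤ ρ / ‖v‖ →
        HasDerivAt (fun t : ℂ => g (y + t • v)) (fderiv ℂ g (y + t • v) v) t := by
      intro t ht
      have h1 : HasFDerivAt g (fderiv ℂ g (y + t • v)) (y + t • v) :=
        (hd.differentiableAt (Metric.isOpen_ball.mem_nhds (hmem t ht))).hasFDerivAt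
      have h2 : HasDerivAt (fun t : ℂ => y + t • v) v t := by
        simpa using ((hasDerivAt_id t).smul_const v).const_add y
      exact h1.comp_hasDerivAt t h2
    have h0 : ‖deriv (fun t : ℂ => g (y + t • v)) 0‖ ≤ C / (ρ / ‖v‖) := by
      refine Complex.norm_deriv_le_of_forall_mem_sphere_norm_le (by positivity) ?_ ?_
      · refine DifferentiableOn.diffContOnCl fun t ht => ?_
        refine (hdiff t ?_).differentiableAt.differentiableWithinAt
        simpa using Metric.closure_ball_subset_closedBall ht
      · intro t ht
        exact hC _ (hmem t (by simpa using (mem_sphere_iff_norm.1 ht).le))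
    rw [(hdiff 0 (by rw [norm_zero]; positivity)).deriv] at h0
    simp only [zero_smul, add_zero] at h0
    rw [div_div_eq_mul_div, le_div_iff₀ hρ] at h0
    exact h0
  have h1 : ‖fderiv ℂ g y v‖ * σ ≤ C * ‖v‖ := by
    have ht : Filter.Tendsto (fun ρ => ‖fderiv ℂ g y v‖ * ρ) (nhdsWithin σ (Set.Iio σ))
        (nhds (‖fderiv ℂ g y v‖ * σ)) :=
      ((continuous_const.mul continuous_id).tendsto σ).mono_left nhdsWithin_le_nhds
    refine le_of_tendsto ht ?_
    filter_upwards [Ioo_mem_nhdsLT hσ] with ρ hρ using key ρ hρ.1 hρ.2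
  rw [div_mul_eq_mul_div, le_div_iff₀ hσ]
  exact h1

end Cauchy

/-! ### Iterated Lie derivatives -/

section IterD

variable {E : Type*} [NormedAddCommGroup E] [NormedSpace ℂ E]

theorem iterD_cons {f : E → E} {L : List (E → E)} (hL : L ≠ []) (y : E) :
    iterD (f :: L) y = fderiv ℂ (iterD L) y (f y) := by
  cases L with
  | nil => exact absurd rfl hL
  | cons g L => rfl

theorem analyticOnNhd_iterD [CompleteSpace E] {U : Set E} {L : List (E → E)}
    (h : ∀ f ∈ L, AnalyticOnNhd ℂ f U) : AnalyticOnNhd ℂ (iterD L) U := by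
  induction L with
  | nil => exact analyticOnNhd_const
  | cons f L ih =>
    have ih' := ih fun g hg => h g (List.mem_cons_of_mem _ hg)
    have hf := h f List.mem_cons_self
    cases L with
    | nil => exact hf
    | cons g L =>
      intro y hy
      exact (ContDiffAt.clm_apply (ih'.fderiv y hy).contDiffAt
        (hf y hy).contDiffAt).analyticAt

/-- Peeling off the outermost field leaves one Fréchet derivative, to which Cauchy's estimate
applies on a ball of radius `σ`. A list of length `i` contains `i - 1` derivatives, hence the
exponent and the enlargement of the radius. -/
theorem norm_iterD_map_le [CompleteSpace E] {ι : Type*} {f : ι → E → E} {b : ι → ℝ} {z : E}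
    {σ : ℝ} (hσ : 0 < σ) {L : List ι} (hL : L ≠ []) {ρ : ℝ} (hb0 : ∀ i ∈ L, 0 ≤ b i)
    (hf : ∀ i ∈ L, AnalyticOnNhd ℂ (f i) (Metric.ball z (ρ + (L.length - 1 : ℕ) * σ)))
    (hb : ∀ i ∈ L, ∀ y ∈ Metric.ball z (ρ + (L.length - 1 : ℕ) * σ), ‖f i y‖ ≤ b i)
    {y : E} (hy : y ∈ Metric.ball z ρ) :
    ‖iterD (L.map f) y‖ ≤ (L.map b).prod / σ ^ (L.length - 1) := by
  induction L generalizing ρ y with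
  | nil => exact absurd rfl hL
  | cons i L ih =>
    by_cases hL' : L = []
    · subst hL'
      simpa [iterD] using hb i (by simp) y (by simpa using hy)
    have hlen : 0 < L.length := List.length_pos_iff.2 hL'
    have hr : ρ + σ + (L.length - 1 : ℕ) * σ = ρ + ((i :: L).length - 1 : ℕ) * σ := by
      rw [List.length_cons, Nat.add_sub_cancel, Nat.cast_sub hlen]; push_cast; ring
    have hsub : Metric.ball z (ρ + σ) ⊆ Metric.ball z (ρ + ((i :: L).length - 1 : ℕ) * σ) := by
      rw [← hr]
      exact Metric.ball_subset_ball (by nlinarith [Nat.cast_nonneg (α := ℝ) (L.length - 1)])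
    have hρ : Metric.ball z ρ ⊆ Metric.ball z (ρ + σ) := Metric.ball_subset_ball (by linarith)
    rw [List.map_cons, iterD_cons (by simpa using hL'), List.map_cons, List.prod_cons,
      List.length_cons, Nat.add_sub_cancel]
    have hball : Metric.ball y σ ⊆ Metric.ball z (ρ + σ) :=
      Metric.ball_subset_ball' (by have := Metric.mem_ball.1 hy; linarith)
    have hder : ‖fderiv ℂ (iterD (L.map f)) y‖ ≤ (L.map b).prod / σ ^ (L.length - 1) / σ := by
      refine norm_fderiv_le_div_of_ball hσ ?_ fun w hw => ?_
      · refine (AnalyticOnNhd.differentiableOn ?_).mono (hball.trans hsub)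
        refine analyticOnNhd_iterD fun g hg => ?_
        obtain ⟨j, hj, rfl⟩ := List.mem_map.1 hg
        exact hf j (List.mem_cons_of_mem _ hj)
      · refine ih hL' (fun j hj => hb0 j (List.mem_cons_of_mem _ hj)) ?_ ?_ (hball hw)
        · rw [hr]; exact fun j hj => hf j (List.mem_cons_of_mem _ hj)
        · rw [hr]; exact fun j hj => hb j (List.mem_cons_of_mem _ hj)
    have hfy : ‖f i y‖ ≤ b i := hb i List.mem_cons_self y (hsub (hρ hy))
    calc ‖fderiv ℂ (iterD (L.map f)) y (f i y)‖
        ≤ ‖fderiv ℂ (iterD (L.map f)) y‖ * ‖f i y‖ := ContinuousLinearMap.le_opNorm _ _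
      _ ≤ (L.map b).prod / σ ^ (L.length - 1) / σ * b i :=
          mul_le_mul hder hfy (norm_nonneg _) ((norm_nonneg _).trans hder)
      _ = b i * (L.map b).prod / σ ^ L.length := by
          obtain ⟨k, hk⟩ := Nat.exists_eq_succ_of_ne_zero hlen.ne'
          rw [hk, Nat.succ_sub_one, pow_succ]; field_simp

theorem norm_iterD_ofFn_le [CompleteSpace E] {ι : Type*} {f : ι → E → E} {b : ι → ℝ} {z : E}
    {σ : ℝ} (hσ : 0 < σ) {i : ℕ} (hi : 1 ≤ i) (k : Fin i → ι) {ρ : ℝ} (hb0 : ∀ j, 0 ≤ b (k j))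
    (hf : ∀ j, AnalyticOnNhd ℂ (f (k j)) (Metric.ball z (ρ + (i - 1 : ℕ) * σ)))
    (hb : ∀ j, ∀ y ∈ Metric.ball z (ρ + (i - 1 : ℕ) * σ), ‖f (k j) y‖ ≤ b (k j))
    {y : E} (hy : y ∈ Metric.ball z ρ) :
    ‖iterD (List.ofFn fun j => f (k j)) y‖ ≤ (∏ j, b (k j)) / σ ^ (i - 1) := by
  have h := norm_iterD_map_le (f := f) (b := b) hσ (L := List.ofFn k) (z := z) (ρ := ρ) (y := y)
    (by rw [← List.length_pos_iff, List.length_ofFn]; exact hi)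
    (by simpa [List.mem_ofFn'] using hb0) (by simpa [List.mem_ofFn'] using hf)
    (by simpa [List.mem_ofFn'] using hb) hy
  rwa [List.map_ofFn, List.map_ofFn, List.length_ofFn, List.prod_ofFn] at h

theorem analyticOnNhd_modCoeff [CompleteSpace E] {n : ℕ} {c : (Fin n → ℕ) → E → E} {U : Set E}
    (hc : ∀ α, 1 ≤ deg α → AnalyticOnNhd ℂ (c α) U) (α : Fin n → ℕ) (hα : 1 ≤ deg α) :
    AnalyticOnNhd ℂ (modCoeff c α) U := by
  induction hd : deg α using Nat.strong_induction_on generalizing α with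
  | _ d ih =>
    subst hd
    have : modCoeff c α = fun y => c α y - ∑ i ∈ Finset.Icc 2 (deg α), (i ! : ℂ)⁻¹ •
        ∑ k ∈ splittings i α, iterD (List.ofFn fun j => modCoeff c (k j)) y :=
      funext fun y => modCoeff_eq c α y
    rw [this]
    intro y hy
    refine (hc α hα y hy).fun_sub (Finset.analyticAt_fun_sum _ fun i hi =>
      AnalyticAt.fun_smul analyticAt_const (Finset.analyticAt_fun_sum _ fun k hk => ?_))
    refine (analyticOnNhd_iterD (U := U) fun f hf => ?_) y hy
    obtain ⟨j, rfl⟩ := List.mem_ofFn.1 hf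
    exact ih _ (deg_lt_of_mem_splittings (Finset.mem_Icc.1 hi).1 hk j) _
      ((mem_splittings.1 hk).1 j) rfl

end IterD

/-! ### Multi-indices and their splittings -/

theorem mem_indexSet {n N : ℕ} {α : Fin n → ℕ} :
    α ∈ indexSet n N ↔ 1 ≤ deg α ∧ deg α ≤ N := by
  simp only [indexSet, Finset.mem_filter, Fintype.mem_piFinset, Finset.mem_range,
    and_iff_right_iff_imp]
  rintro ⟨-, h⟩ l
  exact Nat.lt_succ_of_le
    ((Finset.single_le_sum (f := α) (fun _ _ => Nat.zero_le _) (Finset.mem_univ l)).trans h)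

theorem indexSet_mono {n J N : ℕ} (h : J ≤ N) : indexSet n J ⊆ indexSet n N := fun _ hα =>
  mem_indexSet.2 ⟨(mem_indexSet.1 hα).1, (mem_indexSet.1 hα).2.trans h⟩

theorem deg_sum {n i : ℕ} (k : Fin i → Fin n → ℕ) : deg (∑ j, k j) = ∑ j, deg (k j) := by
  simp only [deg, Finset.sum_apply]
  exact Finset.sum_comm

theorem deg_add_le_of_mem_splittings {n i : ℕ} {α : Fin n → ℕ} {k : Fin i → Fin n → ℕ}
    (hk : k ∈ splittings i α) (j : Fin i) : deg (k j) + (i - 1) ≤ deg α := by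
  obtain ⟨h1, rfl⟩ := mem_splittings.1 hk
  rw [deg_sum, ← Finset.add_sum_erase _ _ (Finset.mem_univ j)]
  refine Nat.add_le_add_left ?_ _
  calc i - 1 = ∑ _j ∈ Finset.univ.erase j, 1 := by simp
    _ ≤ _ := Finset.sum_le_sum fun j _ => h1 j

theorem splittings_eq_empty {n i : ℕ} {α : Fin n → ℕ} (h : deg α < i) : splittings i α = ∅ := by
  refine Finset.eq_empty_of_forall_notMem fun k hk => ?_
  have h1 := deg_add_le_of_mem_splittings hk ⟨0, by omega⟩
  have h2 := (mem_splittings.1 hk).1 ⟨0, by omega⟩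
  omega

/-- The fibres of the map sending a tuple to its sum are the sets of splittings. This turns sums
over `α` into sums over a product set, where they factor. -/
theorem sum_splittings {M : Type*} [AddCommMonoid M] {n i N : ℕ} (hi : 1 ≤ i)
    (g : (Fin i → Fin n → ℕ) → M) :
    ∑ α ∈ indexSet n N, ∑ k ∈ splittings i α, g k =
      ∑ k ∈ Fintype.piFinset (fun _ : Fin i => indexSet n N) with deg (∑ j, k j) ≤ N, g k := by
  have hmaps : ∀ k ∈ {k ∈ Fintype.piFinset (fun _ : Fin i => indexSet n N) | deg (∑ j, k j) ≤ N},
      ∑ j, k j ∈ indexSet n N := by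
    intro k hk
    obtain ⟨hk, hd⟩ := Finset.mem_filter.1 hk
    refine mem_indexSet.2 ⟨?_, hd⟩
    rw [deg_sum]
    exact (mem_indexSet.1 (Fintype.mem_piFinset.1 hk ⟨0, hi⟩)).1.trans
      (Finset.single_le_sum (f := fun j => deg (k j)) (fun _ _ => Nat.zero_le _)
        (Finset.mem_univ _))
  rw [← Finset.sum_fiberwise_of_maps_to hmaps]
  refine Finset.sum_congr rfl fun α hα => Finset.sum_congr ?_ fun _ _ => rfl
  ext k
  simp only [Finset.mem_filter, Fintype.mem_piFinset]
  constructor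
  · intro hk
    have hk' := mem_splittings.1 hk
    refine ⟨⟨fun j => mem_indexSet.2 ⟨hk'.1 j, ?_⟩, ?_⟩, hk'.2⟩
    · exact (Nat.le_add_right _ _).trans
        ((deg_add_le_of_mem_splittings hk j).trans (mem_indexSet.1 hα).2)
    · rw [hk'.2]; exact (mem_indexSet.1 hα).2
  · rintro ⟨⟨h1, -⟩, h2⟩
    exact mem_splittings.2 ⟨fun j => (mem_indexSet.1 (h1 j)).1, h2⟩

/-! ### Majorants for the modified coefficients -/

/-- The majorants of the coefficients of the modified equation: `δ α` bounds the `α`-th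
coefficient of the method and each Lie derivative costs a factor `1 / σ`. -/
noncomputable def majCoeff {n : ℕ} (δ : (Fin n → ℕ) → ℝ) (σ : ℝ) (α : Fin n → ℕ) : ℝ :=
  δ α + ∑ i : Finset.Icc 2 (deg α), ((i.1)! : ℝ)⁻¹ *
    ∑ k : splittings i.1 α, (∏ j, majCoeff δ σ (k.1 j)) / σ ^ (i.1 - 1)
termination_by deg α
decreasing_by exact deg_lt_of_mem_splittings (Finset.mem_Icc.1 i.2).1 k.2 j

theorem majCoeff_eq {n : ℕ} (δ : (Fin n → ℕ) → ℝ) (σ : ℝ) (α : Fin n → ℕ) :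
    majCoeff δ σ α = δ α + ∑ i ∈ Finset.Icc 2 (deg α), (i ! : ℝ)⁻¹ *
      ∑ k ∈ splittings i α, (∏ j, majCoeff δ σ (k j)) / σ ^ (i - 1) := by
  rw [majCoeff, ← Finset.sum_coe_sort (Finset.Icc 2 (deg α))]
  congr 1
  refine Finset.sum_congr rfl fun i _ => ?_
  rw [← Finset.sum_coe_sort (splittings i.1 α)]

theorem majCoeff_nonneg {n : ℕ} {δ : (Fin n → ℕ) → ℝ} {σ : ℝ} (hσ : 0 < σ) (hδ : ∀ α, 0 ≤ δ α)
    (α : Fin n → ℕ) : 0 ≤ majCoeff δ σ α := by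
  induction hd : deg α using Nat.strong_induction_on generalizing α with
  | _ d ih =>
    subst hd
    rw [majCoeff_eq]
    refine add_nonneg (hδ α) (Finset.sum_nonneg fun i hi => mul_nonneg (by positivity)
      (Finset.sum_nonneg fun k hk => div_nonneg (Finset.prod_nonneg fun j _ => ?_) (by positivity)))
    exact ih _ (deg_lt_of_mem_splittings (Finset.mem_Icc.1 hi).1 hk j) _ rfl

/-- The radius shrinks by `σ` per unit of degree. In a splitting into `i` parts each part has degree
at most `|α| - (i - 1)`, so its larger ball has room for exactly the `i - 1` derivatives taken. -/
theorem norm_modCoeff_le {E : Type*} [NormedAddCommGroup E] [NormedSpace ℂ E] [CompleteSpace E]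
    {n : ℕ} {c : (Fin n → ℕ) → E → E} {z : E} {r σ : ℝ} {N : ℕ} {δ : (Fin n → ℕ) → ℝ}
    (hσ : 0 < σ) (hδ : ∀ α, 0 ≤ δ α)
    (hc : ∀ α, 1 ≤ deg α → AnalyticOnNhd ℂ (c α) (Metric.ball z (r + N * σ)))
    (hb : ∀ α, 1 ≤ deg α → ∀ y ∈ Metric.ball z (r + N * σ), ‖c α y‖ ≤ δ α)
    {α : Fin n → ℕ} (hα : α ∈ indexSet n N) {y : E}
    (hy : y ∈ Metric.ball z (r + (N - deg α : ℕ) * σ)) :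
    ‖modCoeff c α y‖ ≤ majCoeff δ σ α := by
  induction hd : deg α using Nat.strong_induction_on generalizing α y with
  | _ d ih =>
    subst hd
    obtain ⟨hα1, hαN⟩ := mem_indexSet.1 hα
    have hsub : ∀ m : ℕ, m ≤ N → Metric.ball z (r + m * σ) ⊆ Metric.ball z (r + N * σ) := by
      intro m hm
      have : (m : ℝ) ≤ N := by exact_mod_cast hm
      exact Metric.ball_subset_ball (by nlinarith)
    rw [modCoeff_eq, majCoeff_eq]
    refine (norm_sub_le _ _).trans (add_le_add (hb α hα1 y (hsub _ (Nat.sub_le _ _) hy)) ?_)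
    refine (norm_sum_le _ _).trans (Finset.sum_le_sum fun i hi => ?_)
    rw [norm_smul, norm_inv, Complex.norm_natCast]
    refine mul_le_mul_of_nonneg_left ?_ (by positivity)
    refine (norm_sum_le _ _).trans (Finset.sum_le_sum fun k hk => ?_)
    obtain ⟨hi2, hiα⟩ := Finset.mem_Icc.1 hi
    have hk1 := (mem_splittings.1 hk).1
    have hkle := deg_add_le_of_mem_splittings hk
    have hrad : r + (N - deg α : ℕ) * σ + (i - 1 : ℕ) * σ = r + (N - deg α + (i - 1) : ℕ) * σ := by
      push_cast; ring
    refine norm_iterD_ofFn_le (f := modCoeff c) (b := majCoeff δ σ) hσ (by omega) k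
      (fun j => majCoeff_nonneg hσ hδ _) (fun j => ?_) (fun j w hw => ?_) hy
    · rw [hrad]
      exact (analyticOnNhd_modCoeff hc _ (hk1 j)).mono
        (hsub _ (by have := hkle j; omega))
    · rw [hrad] at hw
      refine ih _ (deg_lt_of_mem_splittings hi2 hk j) ?_ ?_ rfl
      · exact mem_indexSet.2 ⟨hk1 j, by have := hkle j; omega⟩
      · refine Metric.ball_subset_ball ?_ hw
        have : ((N - deg α + (i - 1) : ℕ) : ℝ) ≤ (N - deg (k j) : ℕ) := by
          have := hkle j
          exact_mod_cast (by omega : N - deg α + (i - 1) ≤ N - deg (k j))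
        nlinarith

theorem sum_half_pow_div_factorial_le (n : ℕ) :
    ∑ i ∈ Finset.Icc 2 n, ((i ! : ℝ)⁻¹ * (1 / 2) ^ i) ≤ 1 / 4 := by
  have h1 : ∀ i ∈ Finset.Icc 2 n, ((i ! : ℝ)⁻¹ * (1 / 2) ^ i) ≤ 1 / 2 * (1 / 2) ^ i := by
    intro i hi
    have h2 : (2 : ℝ) ≤ i ! := by
      exact_mod_cast (Nat.factorial_le (Finset.mem_Icc.1 hi).1 : 2 ! ≤ i !)
    have : ((i ! : ℝ)⁻¹) ≤ 1 / 2 := by rw [one_div]; exact inv_anti₀ (by norm_num) h2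
    exact mul_le_mul_of_nonneg_right this (by positivity)
  refine (Finset.sum_le_sum h1).trans ?_
  rw [← Finset.mul_sum]
  have h3 : ∑ i ∈ Finset.Icc 2 n, (1 / 2 : ℝ) ^ i ≤ 1 / 2 := by
    rcases lt_or_ge n 2 with h | h
    · rw [Finset.Icc_eq_empty (by omega)]; norm_num
    · rw [← Finset.Ico_succ_right_eq_Icc, Nat.succ_eq_succ, Nat.succ_eq_add_one, geom_sum_Ico' (by norm_num) (by omega)]
      have : (0 : ℝ) ≤ (1 / 2) ^ (n + 1) := by positivity
      rw [div_le_iff₀ (by norm_num)]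
      linarith
  linarith

theorem prod_pow_deg {n i : ℕ} (q : ℝ) (k : Fin i → Fin n → ℕ) :
    q ^ deg (∑ j, k j) = ∏ j, q ^ deg (k j) := by
  rw [deg_sum, Finset.prod_pow_eq_pow_sum]

/-- If `S ≤ σ/2` is the weighted sum up to degree `J`, the recursion bounds the next one by `σ/4 +
∑_{i≥2} S^i / (i! σ^{i-1}) ≤ σ/4 + σ ∑_{i≥2} 2^{-i}/i!`, which is again at most `σ/2`. -/
theorem sum_majCoeff_le {n : ℕ} {δ : (Fin n → ℕ) → ℝ} {σ q : ℝ} {N : ℕ} (hσ : 0 < σ) (hq : 0 ≤ q)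
    (hδ : ∀ α, 0 ≤ δ α) (hsum : ∑ α ∈ indexSet n N, q ^ deg α * δ α ≤ σ / 4) :
    ∑ α ∈ indexSet n N, q ^ deg α * majCoeff δ σ α ≤ σ / 2 := by
  suffices H : ∀ J ≤ N, ∑ α ∈ indexSet n J, q ^ deg α * majCoeff δ σ α ≤ σ / 2 from H N le_rfl
  have hnn := majCoeff_nonneg hσ hδ
  intro J
  induction J with
  | zero =>
    intro _
    have : indexSet n 0 = ∅ := Finset.eq_empty_of_forall_notMem fun α hα => by
      have := mem_indexSet.1 hα; omega
    rw [this, Finset.sum_empty]; positivity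
  | succ J ih =>
    intro hJ
    have hS := ih (by omega)
    set S := ∑ α ∈ indexSet n J, q ^ deg α * majCoeff δ σ α with hSdef
    have hS0 : 0 ≤ S := Finset.sum_nonneg fun α _ => mul_nonneg (by positivity) (hnn α)
    have hterm0 : ∀ (i : ℕ) (k : Fin i → Fin n → ℕ),
        0 ≤ (∏ j, q ^ deg (k j) * majCoeff δ σ (k j)) / σ ^ (i - 1) := fun i k =>
      div_nonneg (Finset.prod_nonneg fun j _ => mul_nonneg (by positivity) (hnn _)) (by positivity)
    have h1 : ∀ α ∈ indexSet n (J + 1), q ^ deg α * majCoeff δ σ α ≤ q ^ deg α * δ α +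
        ∑ i ∈ Finset.Icc 2 (J + 1), (i ! : ℝ)⁻¹ *
          ∑ k ∈ splittings i α, (∏ j, q ^ deg (k j) * majCoeff δ σ (k j)) / σ ^ (i - 1) := by
      intro α hα
      rw [majCoeff_eq, mul_add, Finset.mul_sum]
      refine add_le_add le_rfl ?_
      calc ∑ i ∈ Finset.Icc 2 (deg α), q ^ deg α * ((i ! : ℝ)⁻¹ *
            ∑ k ∈ splittings i α, (∏ j, majCoeff δ σ (k j)) / σ ^ (i - 1))
          = ∑ i ∈ Finset.Icc 2 (deg α), (i ! : ℝ)⁻¹ *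
          ∑ k ∈ splittings i α, (∏ j, q ^ deg (k j) * majCoeff δ σ (k j)) / σ ^ (i - 1) := by
            refine Finset.sum_congr rfl fun i _ => ?_
            rw [mul_left_comm, Finset.mul_sum]
            congr 1
            refine Finset.sum_congr rfl fun k hk => ?_
            rw [Finset.prod_mul_distrib, ← prod_pow_deg, (mem_splittings.1 hk).2, mul_div_assoc]
        _ ≤ _ := Finset.sum_le_sum_of_subset_of_nonneg
            (Finset.Icc_subset_Icc_right (mem_indexSet.1 hα).2) fun i _ _ =>
              mul_nonneg (by positivity) (Finset.sum_nonneg fun k _ => hterm0 i k)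
    refine (Finset.sum_le_sum h1).trans ?_
    rw [Finset.sum_add_distrib, Finset.sum_comm]
    have h2 : ∑ α ∈ indexSet n (J + 1), q ^ deg α * δ α ≤ σ / 4 :=
      (Finset.sum_le_sum_of_subset_of_nonneg (indexSet_mono hJ) fun α _ _ =>
        mul_nonneg (by positivity) (hδ α)).trans hsum
    have h3 : ∀ i ∈ Finset.Icc 2 (J + 1), ∑ α ∈ indexSet n (J + 1), (i ! : ℝ)⁻¹ *
          ∑ k ∈ splittings i α, (∏ j, q ^ deg (k j) * majCoeff δ σ (k j)) / σ ^ (i - 1) ≤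
        σ * ((i ! : ℝ)⁻¹ * (1 / 2) ^ i) := by
      intro i hi
      obtain ⟨hi2, -⟩ := Finset.mem_Icc.1 hi
      rw [← Finset.mul_sum, mul_left_comm]
      refine mul_le_mul_of_nonneg_left ?_ (by positivity)
      -- With at least two parts, every part has degree at most `J`. Dropping the constraint on the
      -- total degree leaves a full product set, whose sum is `S ^ i`.
      have hsplit : ∑ α ∈ indexSet n (J + 1),
          ∑ k ∈ splittings i α, (∏ j, q ^ deg (k j) * majCoeff δ σ (k j)) / σ ^ (i - 1) ≤
          ∑ k ∈ Fintype.piFinset (fun _ : Fin i => indexSet n J),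
            (∏ j, q ^ deg (k j) * majCoeff δ σ (k j)) / σ ^ (i - 1) := by
        rw [sum_splittings (by omega)]
        refine Finset.sum_le_sum_of_subset_of_nonneg (fun k hk => ?_) fun k _ _ => hterm0 i k
        obtain ⟨hk, hd⟩ := Finset.mem_filter.1 hk
        rw [Fintype.mem_piFinset] at hk ⊢
        intro j
        have hk1 := fun j => (mem_indexSet.1 (hk j)).1
        have := deg_lt_of_mem_splittings hi2 (mem_splittings.2 ⟨hk1, rfl⟩) j
        exact mem_indexSet.2 ⟨hk1 j, by omega⟩
      refine hsplit.trans ?_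
      rw [← Finset.sum_div, ← Finset.prod_univ_sum (fun _ : Fin i => indexSet n J)
        (fun _ α => q ^ deg α * majCoeff δ σ α), ← hSdef, Finset.prod_const, Finset.card_univ,
        Fintype.card_fin]
      obtain ⟨k, rfl⟩ := Nat.exists_eq_add_of_le hi2
      rw [div_le_iff₀ (by positivity), show 2 + k - 1 = k + 1 by omega]
      calc S ^ (2 + k) ≤ (σ / 2) ^ (2 + k) := by gcongr
        _ = σ * (1 / 2) ^ (2 + k) * σ ^ (k + 1) := by rw [div_pow, div_pow]; ring
    have h4 := (Finset.sum_le_sum h3)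
    rw [← Finset.mul_sum] at h4
    have h5 := sum_half_pow_div_factorial_le (J + 1)
    nlinarith

/-! ### The Lie series of the truncated field -/

theorem sum_piFinset_cons {ι M : Type*} [AddCommMonoid M] (A : Finset ι) {m : ℕ}
    (g : (Fin (m + 1) → ι) → M) :
    ∑ k ∈ Fintype.piFinset (fun _ : Fin (m + 1) => A), g k =
      ∑ α ∈ A, ∑ k ∈ Fintype.piFinset (fun _ : Fin m => A), g (Fin.cons α k) := by
  rw [← Finset.sum_product']
  refine Finset.sum_nbij' (fun k => (k 0, Fin.tail k)) (fun p => Fin.cons p.1 p.2) ?_ ?_ ?_ ?_ ?_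
  · intro k hk
    rw [Fintype.mem_piFinset] at hk
    exact Finset.mem_product.2 ⟨hk 0, Fintype.mem_piFinset.2 fun j => hk j.succ⟩
  · intro p hp
    obtain ⟨h1, h2⟩ := Finset.mem_product.1 hp
    rw [Fintype.mem_piFinset] at h2 ⊢
    intro j
    refine Fin.cases ?_ (fun j => ?_) j
    · simpa using h1
    · simpa using h2 j
  · intro k _
    exact Fin.cons_self_tail k
  · intro p _
    simp
  · intro k _
    rw [Fin.cons_self_tail]

/-- Lie derivatives are linear in each field. The open set is needed because the inductive identity
is differentiated, so it must hold near the point. -/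
theorem iterD_replicate_sum {E : Type*} [NormedAddCommGroup E] [NormedSpace ℂ E]
    [CompleteSpace E] {ι : Type*} {f : ι → E → E} {A : Finset ι} {U : Set E} (hU : IsOpen U)
    (hf : ∀ α ∈ A, AnalyticOnNhd ℂ (f α) U) (w : ι → ℂ) (i : ℕ) {y : E} (hy : y ∈ U) :
    iterD (List.replicate (i + 1) fun y => ∑ α ∈ A, w α • f α y) y =
      ∑ k ∈ Fintype.piFinset (fun _ : Fin (i + 1) => A),
        (∏ j, w (k j)) • iterD (List.ofFn fun j => f (k j)) y := by
  induction i generalizing y with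
  | zero =>
    rw [sum_piFinset_cons]
    simp [iterD]
  | succ i ih =>
    rw [List.replicate_succ, iterD_cons (by simp), sum_piFinset_cons, Finset.sum_comm]
    have hev : iterD (List.replicate (i + 1) fun y => ∑ α ∈ A, w α • f α y) =ᶠ[nhds y]
        fun y => ∑ k ∈ Fintype.piFinset (fun _ : Fin (i + 1) => A),
        (∏ j, w (k j)) • iterD (List.ofFn fun j => f (k j)) y :=
      Filter.eventually_of_mem (hU.mem_nhds hy) fun y hy => ih hy
    have hdiff : ∀ k ∈ Fintype.piFinset (fun _ : Fin (i + 1) => A),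
        DifferentiableAt ℂ (iterD (List.ofFn fun j => f (k j))) y := by
      intro k hk
      refine (analyticOnNhd_iterD (U := U) (fun g hg => ?_) y hy).differentiableAt
      obtain ⟨j, rfl⟩ := List.mem_ofFn.1 hg
      exact hf _ (Fintype.mem_piFinset.1 hk j)
    rw [hev.fderiv_eq, (HasFDerivAt.fun_sum fun k hk =>
      ((hdiff k hk).hasFDerivAt.fun_const_smul (∏ j, w (k j)))).fderiv,
      _root_.sum_apply]
    refine Finset.sum_congr rfl fun k hk => ?_
    rw [map_sum]
    refine Finset.sum_congr rfl fun α _ => ?_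
    have hcons : (List.ofFn fun j => f ((Fin.cons α k : Fin (i + 1 + 1) → ι) j)) =
        f α :: List.ofFn fun j => f (k j) := by
      rw [List.ofFn_succ]; simp only [Fin.cons_zero, Fin.cons_succ]
    have hprod : ∏ j, w ((Fin.cons α k : Fin (i + 1 + 1) → ι) j) = (∏ j, w (k j)) * w α := by
      rw [Fin.prod_univ_succ, mul_comm]; simp only [Fin.cons_zero, Fin.cons_succ]
    rw [hcons, hprod, iterD_cons (by simp), _root_.smul_apply, map_smul, smul_smul]

theorem splittings_one {n : ℕ} {α : Fin n → ℕ} (hα : 1 ≤ deg α) :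
    splittings 1 α = {fun _ => α} := by
  ext k
  rw [mem_splittings, Finset.mem_singleton]
  constructor
  · rintro ⟨-, h⟩
    ext1 j
    rw [Subsingleton.elim j 0, ← h, Fin.sum_univ_one]
  · rintro rfl
    exact ⟨fun _ => hα, by simp⟩

/-- The defining recursion of `modCoeff`, solved for the coefficients of the method. -/
theorem sum_iterD_splittings {E : Type*} [NormedAddCommGroup E] [NormedSpace ℂ E] {n N : ℕ} (c : (Fin n → ℕ) → E → E) {α : Fin n → ℕ}
    (hα : α ∈ indexSet n N) (y : E) :
    ∑ i ∈ Finset.Icc 1 N, (i ! : ℂ)⁻¹ •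
      ∑ k ∈ splittings i α, iterD (List.ofFn fun j => modCoeff c (k j)) y = c α y := by
  obtain ⟨h1, hN⟩ := mem_indexSet.1 hα
  rw [← Finset.sum_subset (Finset.Icc_subset_Icc_right hN) fun i hi hi' => ?_]
  · rw [← Finset.add_sum_Ioc_eq_sum_Icc h1, splittings_one h1, Finset.sum_singleton]
    have : Finset.Ioc 1 (deg α) = Finset.Icc 2 (deg α) := by ext; simp; omega
    rw [this]
    simp only [Nat.factorial_one, Nat.cast_one, inv_one, one_smul, List.ofFn_succ, List.ofFn_zero,
      iterD]
    rw [modCoeff_eq, sub_add_cancel]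
  · rw [splittings_eq_empty, Finset.sum_empty, smul_zero]
    simp only [Finset.mem_Icc, not_and, not_le] at hi hi'
    exact hi' hi.1

theorem prod_pow_sum {n i : ℕ} (x : Fin n → ℂ) (k : Fin i → Fin n → ℕ) :
    ∏ l, x l ^ (∑ j, k j) l = ∏ j, ∏ l, x l ^ k j l := by
  rw [Finset.prod_comm]
  simp only [Finset.sum_apply, Finset.prod_pow_eq_pow_sum]

theorem norm_prod_pow_le {n : ℕ} {x : Fin n → ℂ} {ρ : ℝ} (hx : ∀ l, ‖x l‖ ≤ ρ) (α : Fin n → ℕ) :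
    ‖∏ l, x l ^ α l‖ ≤ ρ ^ deg α := by
  rw [norm_prod, deg, ← Finset.prod_pow_eq_pow_sum]
  refine Finset.prod_le_prod (fun _ _ => norm_nonneg _) fun l _ => ?_
  rw [norm_pow]
  exact pow_le_pow_left₀ (norm_nonneg _) (hx l) _

/-- The truncated Lie series of the truncated modified vector field reproduces the truncated
expansion of the method, up to a small error. -/
theorem norm_lieSeries_sub_le {E : Type*} [NormedAddCommGroup E] [NormedSpace ℂ E]
    [CompleteSpace E] {n N : ℕ} {c : (Fin n → ℕ) → E → E} {z : E} {σ ρ T : ℝ}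
    {x : Fin n → ℂ} {β : (Fin n → ℕ) → ℝ} (hN : 1 ≤ N) (hσ : 0 < σ) (hρ : 0 ≤ ρ) (hT : 1 ≤ T)
    (hx : ∀ l, ‖x l‖ ≤ ρ) (hβ : ∀ α, 0 ≤ β α)
    (hf : ∀ α ∈ indexSet n N, AnalyticOnNhd ℂ (modCoeff c α) (Metric.ball z (N * σ)))
    (hb : ∀ α ∈ indexSet n N, ∀ y ∈ Metric.ball z (N * σ), ‖modCoeff c α y‖ ≤ β α)
    (hS : ∑ α ∈ indexSet n N, (T * ρ) ^ deg α * β α ≤ σ / 2) :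
    ‖∑ i ∈ Finset.Icc 1 N, (i ! : ℂ)⁻¹ • iterD (List.replicate i fun y =>
        ∑ α ∈ indexSet n N, (∏ l, x l ^ α l) • modCoeff c α y) z -
      ∑ α ∈ indexSet n N, (∏ l, x l ^ α l) • c α z‖ ≤ σ / T ^ (N + 1) := by
  have hN' : (1 : ℝ) ≤ N := by exact_mod_cast hN
  have hz : z ∈ Metric.ball z (N * σ) := Metric.mem_ball_self (by positivity)
  set w : (Fin n → ℕ) → ℂ := fun α => ∏ l, x l ^ α l with hw
  set term : (i : ℕ) → (Fin i → Fin n → ℕ) → E := fun i k =>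
    (∏ j, w (k j)) • iterD (List.ofFn fun j => modCoeff c (k j)) z with hterm
  set A : (i : ℕ) → Finset (Fin i → Fin n → ℕ) := fun i =>
    Fintype.piFinset fun _ : Fin i => indexSet n N with hA
  -- Tuples are separated by total degree. Those of degree at most `N` are grouped by their sum and
  -- will cancel against the method; the others are the error.
  have hexp : ∀ i ∈ Finset.Icc 1 N, iterD (List.replicate i fun y =>
        ∑ α ∈ indexSet n N, w α • modCoeff c α y) z = ∑ α ∈ indexSet n N, w α •
          ∑ k ∈ splittings i α, iterD (List.ofFn fun j => modCoeff c (k j)) z +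
        ∑ k ∈ A i with ¬ deg (∑ j, k j) ≤ N, term i k := by
    intro i hi
    obtain ⟨hi1, -⟩ := Finset.mem_Icc.1 hi
    obtain ⟨m, rfl⟩ := Nat.exists_eq_succ_of_ne_zero (by omega : i ≠ 0)
    rw [iterD_replicate_sum Metric.isOpen_ball hf w m hz,
      ← Finset.sum_filter_add_sum_filter_not _ (fun k => deg (∑ j, k j) ≤ N),
      ← sum_splittings hi1]
    congr 1
    refine Finset.sum_congr rfl fun α _ => ?_
    rw [Finset.smul_sum]
    refine Finset.sum_congr rfl fun k hk => ?_
    rw [← (mem_splittings.1 hk).2, hw]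
    simp only [prod_pow_sum]
  have hmain : ∑ i ∈ Finset.Icc 1 N, (i ! : ℂ)⁻¹ • iterD (List.replicate i fun y =>
        ∑ α ∈ indexSet n N, w α • modCoeff c α y) z - ∑ α ∈ indexSet n N, w α • c α z =
      ∑ i ∈ Finset.Icc 1 N, (i ! : ℂ)⁻¹ • ∑ k ∈ A i with ¬ deg (∑ j, k j) ≤ N, term i k := by
    rw [Finset.sum_congr rfl fun i hi => by rw [hexp i hi, smul_add], Finset.sum_add_distrib,
      add_sub_right_comm, add_eq_right, sub_eq_zero]
    simp only [Finset.smul_sum (r := ((_ : ℕ) : ℂ)⁻¹) (s := indexSet n N)]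
    rw [Finset.sum_comm]
    refine Finset.sum_congr rfl fun α hα => ?_
    rw [← sum_iterD_splittings c hα z, Finset.smul_sum]
    exact Finset.sum_congr rfl fun i _ => smul_comm _ _ _
  rw [hmain]
  have hT0 : 0 < T := by linarith
  set S := ∑ α ∈ indexSet n N, (T * ρ) ^ deg α * β α with hSdef
  have hterm_le : ∀ i ∈ Finset.Icc 1 N, ‖∑ k ∈ A i with ¬ deg (∑ j, k j) ≤ N, term i k‖ ≤
      σ / T ^ (N + 1) * (1 / 2) ^ i := by
    intro i hi
    obtain ⟨hi1, hiN⟩ := Finset.mem_Icc.1 hi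
    have h1 : ∀ k ∈ A i, ¬ deg (∑ j, k j) ≤ N → ‖term i k‖ ≤
        (∏ j, (T * ρ) ^ deg (k j) * β (k j)) / σ ^ (i - 1) / T ^ (N + 1) := by
      intro k hk hd
      rw [Fintype.mem_piFinset] at hk
      have hsub : Metric.ball z (σ + (i - 1 : ℕ) * σ) ⊆ Metric.ball z (N * σ) := by
        have : ((i - 1 : ℕ) : ℝ) + 1 ≤ N := by exact_mod_cast (by omega : i - 1 + 1 ≤ N)
        exact Metric.ball_subset_ball (by nlinarith)
      have h2 := norm_iterD_ofFn_le (f := modCoeff c) (b := β) hσ hi1 k (z := z) (ρ := σ)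
        (fun j => hβ _) (fun j => (hf _ (hk j)).mono hsub) (fun j y hy => hb _ (hk j) y (hsub hy))
        (Metric.mem_ball_self hσ)
      have h3 : ‖∏ j, w (k j)‖ ≤ ρ ^ deg (∑ j, k j) := by
        rw [prod_pow_deg, norm_prod]
        exact Finset.prod_le_prod (fun _ _ => norm_nonneg _) fun j _ => norm_prod_pow_le hx _
      -- The gain: the total degree is at least `N + 1`, so enlarging the weight to `T * ρ` leaves a
      -- factor `T ^ (N + 1)` to spare.
      have h4 : ρ ^ deg (∑ j, k j) ≤ (T * ρ) ^ deg (∑ j, k j) / T ^ (N + 1) := by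
        rw [le_div_iff₀ (by positivity), mul_pow, mul_comm]
        exact mul_le_mul_of_nonneg_right (pow_le_pow_right₀ hT (by omega)) (by positivity)
      have h5 : 0 ≤ (∏ j, β (k j)) / σ ^ (i - 1) :=
        div_nonneg (Finset.prod_nonneg fun j _ => hβ _) (by positivity)
      rw [hterm, norm_smul]
      refine (mul_le_mul (h3.trans h4) h2 (norm_nonneg _) (by positivity)).trans_eq ?_
      rw [prod_pow_deg, Finset.prod_mul_distrib]
      ring
    have h6 : ∀ k : Fin i → Fin n → ℕ,
        0 ≤ (∏ j, (T * ρ) ^ deg (k j) * β (k j)) / σ ^ (i - 1) / T ^ (N + 1) := fun k =>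
      div_nonneg (div_nonneg (Finset.prod_nonneg fun j _ => mul_nonneg (by positivity) (hβ _))
        (by positivity)) (by positivity)
    have hS0 : 0 ≤ S := Finset.sum_nonneg fun α _ => mul_nonneg (by positivity) (hβ α)
    calc ‖∑ k ∈ A i with ¬ deg (∑ j, k j) ≤ N, term i k‖
        ≤ ∑ k ∈ A i with ¬ deg (∑ j, k j) ≤ N,
          (∏ j, (T * ρ) ^ deg (k j) * β (k j)) / σ ^ (i - 1) / T ^ (N + 1) :=
          (norm_sum_le _ _).trans (Finset.sum_le_sum fun k hk =>
            h1 k (Finset.mem_filter.1 hk).1 (Finset.mem_filter.1 hk).2)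
      _ ≤ ∑ k ∈ A i, (∏ j, (T * ρ) ^ deg (k j) * β (k j)) / σ ^ (i - 1) / T ^ (N + 1) :=
          Finset.sum_le_sum_of_subset_of_nonneg (Finset.filter_subset _ _) fun k _ _ => h6 k
      _ = S ^ i / σ ^ (i - 1) / T ^ (N + 1) := by
          rw [← Finset.sum_div, ← Finset.sum_div, hA,
            ← Finset.prod_univ_sum (fun _ : Fin i => indexSet n N)
              (fun _ α => (T * ρ) ^ deg α * β α), ← hSdef, Finset.prod_const, Finset.card_univ,
            Fintype.card_fin]
      _ ≤ (σ / 2) ^ i / σ ^ (i - 1) / T ^ (N + 1) := by gcongr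
      _ = σ / T ^ (N + 1) * (1 / 2) ^ i := by
          obtain ⟨m, rfl⟩ := Nat.exists_eq_succ_of_ne_zero (by omega : i ≠ 0)
          have : (σ / 2) ^ m.succ = σ * (1 / 2) ^ m.succ * σ ^ m := by
            rw [div_pow, one_div_pow, pow_succ]; ring
          rw [Nat.succ_sub_one, this, mul_div_cancel_right₀ _ (by positivity)]
          ring
  have hnorm : ∀ i ∈ Finset.Icc 1 N,
      ‖(i ! : ℂ)⁻¹ • ∑ k ∈ A i with ¬ deg (∑ j, k j) ≤ N, term i k‖ ≤
        σ / T ^ (N + 1) * ((i ! : ℝ)⁻¹ * (1 / 2) ^ i) := by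
    intro i hi
    rw [norm_smul, norm_inv, Complex.norm_natCast, mul_left_comm]
    exact mul_le_mul_of_nonneg_left (hterm_le i hi) (by positivity)
  refine (norm_sum_le _ _).trans ((Finset.sum_le_sum hnorm).trans ?_)
  rw [← Finset.mul_sum]
  refine mul_le_of_le_one_right (by positivity) ?_
  rw [← Finset.add_sum_Ioc_eq_sum_Icc hN]
  have h7 : Finset.Ioc 1 N = Finset.Icc 2 N := by ext; simp; omega
  have h8 := sum_half_pow_div_factorial_le N
  rw [h7]
  norm_num at h8 ⊢
  linarith

/-! ### Solutions of the autonomous equation -/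

theorem norm_sub_taylor_le {E : Type*} [NormedAddCommGroup E] [NormedSpace ℝ E] {G : ℕ → ℝ → E}
    {N : ℕ} {C : ℝ}
    (hG : ∀ i, ∀ t ∈ Set.Icc (0 : ℝ) 1, HasDerivWithinAt (G i) (G (i + 1) t) (Set.Icc 0 1) t)
    (hC : ∀ t ∈ Set.Icc (0 : ℝ) 1, ‖G (N + 1) t‖ ≤ C) :
    ‖G 0 1 - ∑ i ∈ Finset.range (N + 1), (i ! : ℝ)⁻¹ • G i 0‖ ≤ C / N ! := by
  have hu : UniqueDiffOn ℝ (Set.Icc (0 : ℝ) 1) := uniqueDiffOn_Icc_zero_one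
  have hit : ∀ i, ∀ t ∈ Set.Icc (0 : ℝ) 1,
      iteratedDerivWithin i (G 0) (Set.Icc 0 1) t = G i t := by
    intro i
    induction i with
    | zero => intro t _; rw [iteratedDerivWithin_zero]
    | succ i ih =>
      intro t ht
      rw [iteratedDerivWithin_succ, derivWithin_congr (fun s hs => ih s hs) (ih t ht)]
      exact (hG i t ht).derivWithin (hu t ht)
  have hcd : ContDiffOn ℝ (N + 1) (G 0) (Set.Icc 0 1) := by
    have := contDiffOn_of_differentiableOn_deriv (n := ((N + 1 : ℕ) : ℕ∞)) (f := G 0)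
      (s := Set.Icc (0 : ℝ) 1) fun m _ t ht => by
        refine DifferentiableWithinAt.congr (f := G m) (hG m t ht).differentiableWithinAt
          (fun s hs => hit m s hs) (hit m t ht)
    exact_mod_cast this
  have h := taylor_mean_remainder_bound (a := 0) (b := 1) (x := 1) (C := C) (n := N) zero_le_one hcd
    (by simp) fun t ht => by rw [hit _ t ht]; exact hC t ht
  rw [taylor_within_apply] at h
  simp only [sub_zero, one_pow, mul_one] at h
  rwa [Finset.sum_congr rfl fun i _ => by rw [hit i 0 (by simp)]] at h

/-- A solution cannot leave a ball on which the field is small. -/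
theorem IsSolution.mem_ball {E : Type*} [NormedAddCommGroup E] [NormedSpace ℝ E]
    {F : E → E} {z : E} {r B : ℝ} {u : ℝ → E} (hr : 0 < r)
    (hB : B ≤ r / 2) (hF : ∀ y ∈ Metric.ball z r, ‖F y‖ ≤ B) (hu : IsSolution F 1 z u) {t : ℝ}
    (ht : t ∈ Set.Icc (0 : ℝ) 1) : u t ∈ Metric.ball z r := by
  have hcont : ContinuousOn u (Set.Icc 0 1) := fun t ht => (hu.2 t ht).continuousWithinAt
  -- The barrier has slope `3/4 r`: strictly above the speed bound `r/2`, yet below `r` up to time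
  -- one.
  have h := image_norm_le_of_norm_deriv_right_lt_deriv_boundary' (a := 0) (b := 1)
    (f := fun t => u t - z) (f' := fun t => F (u t)) (B := fun t => 3 / 4 * r * t)
    (B' := fun _ => 3 / 4 * r) (hcont.sub continuousOn_const) ?_ ?_ (by fun_prop) ?_ ?_ ht
  · rw [mem_ball_iff_norm]
    refine h.trans_lt ?_
    nlinarith [ht.1, ht.2]
  · intro t ht
    exact (((hu.2 t ⟨ht.1, ht.2.le⟩).mono_of_mem_nhdsWithin
      (Icc_mem_nhdsGE_of_mem ht)).sub_const z)
  · simp [hu.1]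
  · intro t _
    simpa using ((hasDerivAt_id t).const_mul (3 / 4 * r)).hasDerivWithinAt
  · intro t ht heq
    have : u t ∈ Metric.ball z r := by
      rw [mem_ball_iff_norm, heq]
      nlinarith [ht.1, ht.2]
    have := hF _ this
    linarith

theorem lipschitzOnWith_closedBall {E F : Type*} [NormedAddCommGroup E] [NormedSpace ℂ E]
    [NormedSpace ℝ E] [NormedAddCommGroup F] [NormedSpace ℂ F]
    {g : E → F} {z : E} {r σ : ℝ} {B : NNReal} (hσ : 0 < σ)
    (hg : DifferentiableOn ℂ g (Metric.ball z (r + σ)))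
    (hB : ∀ y ∈ Metric.ball z (r + σ), ‖g y‖ ≤ B) :
    LipschitzOnWith (B / σ.toNNReal) g (Metric.closedBall z r) := by
  have hsub : ∀ y ∈ Metric.closedBall z r, Metric.ball y σ ⊆ Metric.ball z (r + σ) :=
    fun y hy => Metric.ball_subset_ball' (by have := Metric.mem_closedBall.1 hy; linarith)
  refine Convex.lipschitzOnWith_of_nnnorm_fderiv_le (𝕜 := ℂ) (fun y hy => ?_) (fun y hy => ?_)
    (convex_closedBall z r)
  · exact hg.differentiableAt (Metric.isOpen_ball.mem_nhds (hsub y hy (Metric.mem_ball_self hσ)))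
  · have := norm_fderiv_le_div_of_ball hσ (hg.mono (hsub y hy)) fun w hw => hB w (hsub y hy hw)
    rw [← NNReal.coe_le_coe, coe_nnnorm, NNReal.coe_div, Real.coe_toNNReal _ hσ.le]
    exact this

/-- Existence and uniqueness, on the unit interval, of the solution of an autonomous equation whose
right-hand side is holomorphic and small on a ball. -/
theorem exists_isSolution {E : Type*} [NormedAddCommGroup E] [NormedSpace ℂ E] [CompleteSpace E]
    [NormedSpace ℝ E] [IsScalarTower ℝ ℂ E] {F : E → E} {z : E} {r B : ℝ} (hr : 0 < r) (hB : B ≤ r / 2)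
    (hF : DifferentiableOn ℂ F (Metric.ball z (r + r)))
    (hFB : ∀ y ∈ Metric.ball z (r + r), ‖F y‖ ≤ B) :
    ∃ u, IsSolution F 1 z u ∧ ∀ v, IsSolution F 1 z v → Set.EqOn v u (Set.Icc 0 1) := by
  have hB0 : 0 ≤ B := (norm_nonneg _).trans (hFB z (Metric.mem_ball_self (by linarith)))
  have hlip := lipschitzOnWith_closedBall (B := ⟨B, hB0⟩) hr hF hFB
  have hsub : Metric.closedBall z r ⊆ Metric.ball z (r + r) :=
    Metric.closedBall_subset_ball (by linarith)
  have hpl : IsPicardLindelof (fun _ => F) (⟨0, by simp⟩ : Set.Icc (0 : ℝ) 1) z ⟨r, hr.le⟩ 0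
      ⟨B, hB0⟩ _ :=
    IsPicardLindelof.of_time_independent (fun y hy => hFB y (hsub hy)) hlip (by
      simp only [sub_zero, sub_self, NNReal.coe_zero]
      rw [max_eq_left zero_le_one]
      change B * 1 ≤ r
      linarith)
  obtain ⟨u, hu0, hu⟩ := hpl.exists_eq_forall_mem_Icc_hasDerivWithinAt₀
  have hus : IsSolution F 1 z u := ⟨hu0, hu⟩
  have hball : ∀ y ∈ Metric.ball z r, ‖F y‖ ≤ B := fun y hy =>
    hFB y (hsub (Metric.ball_subset_closedBall hy))
  refine ⟨u, hus, fun v hv => ?_⟩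
  have hright : ∀ {v : ℝ → E}, IsSolution F 1 z v → ∀ t ∈ Set.Ico (0 : ℝ) 1,
      HasDerivWithinAt v (F (v t)) (Set.Ici t) t := fun hv t ht =>
    (hv.2 t ⟨ht.1, ht.2.le⟩).mono_of_mem_nhdsWithin (Icc_mem_nhdsGE_of_mem ht)
  -- Every solution is confined to the ball where the field is Lipschitz, so uniqueness holds
  -- without assuming that the competitor stays there.
  exact ODE_solution_unique_of_mem_Icc_right (v := fun _ => F) (s := fun _ => Metric.closedBall z r)
    (fun t _ => hlip) (fun t ht => (hv.2 t ht).continuousWithinAt) (hright hv)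
    (fun t ht => Metric.ball_subset_closedBall (hv.mem_ball hr hB hball ⟨ht.1, ht.2.le⟩))
    (fun t ht => (hus.2 t ht).continuousWithinAt) (hright hus)
    (fun t ht => Metric.ball_subset_closedBall (hus.mem_ball hr hB hball ⟨ht.1, ht.2.le⟩))
    (hv.1.trans hu0.symm)

/-- Taylor's formula for a solution of an autonomous equation, with its coefficients expressed by
iterated Lie derivatives. -/
theorem IsSolution.norm_sub_lieSeries_le {E : Type*} [NormedAddCommGroup E] [NormedSpace ℂ E] [CompleteSpace E]
    [NormedSpace ℝ E] [IsScalarTower ℝ ℂ E] {F : E → E} {z : E} {U : Set E} {u : ℝ → E} {N : ℕ} {C : ℝ}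
    (hF : AnalyticOnNhd ℂ F U) (hu : IsSolution F 1 z u)
    (huU : ∀ t ∈ Set.Icc (0 : ℝ) 1, u t ∈ U)
    (hC : ∀ t ∈ Set.Icc (0 : ℝ) 1, ‖iterD (List.replicate (N + 1) F) (u t)‖ ≤ C) :
    ‖u 1 - (z + ∑ i ∈ Finset.Icc 1 N, (i ! : ℂ)⁻¹ • iterD (List.replicate i F) z)‖ ≤ C / N ! := by
  -- Index `0` is treated apart: `iterD` of the empty list is `0`, whereas the zeroth derivative of
  -- the solution is the solution itself.
  have hC' : ∀ t ∈ Set.Icc (0 : ℝ) 1, ‖(fun i t => match i with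
      | 0 => u t
      | i + 1 => iterD (List.replicate (i + 1) F) (u t) : ℕ → ℝ → E) (N + 1) t‖ ≤ C := hC
  have h := norm_sub_taylor_le (G := fun i t => match i with
    | 0 => u t
    | i + 1 => iterD (List.replicate (i + 1) F) (u t)) (fun i t ht => ?_) hC'
  · rw [Finset.sum_range_succ'] at h
    simp only [Nat.factorial_zero, Nat.cast_one, inv_one, one_smul, hu.1] at h
    have hsum : ∑ i ∈ Finset.Icc 1 N, (i ! : ℂ)⁻¹ • iterD (List.replicate i F) z =
        ∑ i ∈ Finset.range N, ((i + 1)! : ℝ)⁻¹ • iterD (List.replicate (i + 1) F) z := by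
      rw [← Finset.Ico_succ_right_eq_Icc, Finset.sum_Ico_eq_sum_range]
      refine Finset.sum_congr (by simp) fun i _ => ?_
      rw [add_comm 1 i, inv_natCast_smul_eq ℂ ℝ]
    rw [hsum, add_comm z]
    exact h
  · cases i with
    | zero => exact hu.2 t ht
    | succ i =>
      have hd : HasFDerivAt (iterD (List.replicate (i + 1) F))
          (fderiv ℂ (iterD (List.replicate (i + 1) F)) (u t)) (u t) := by
        refine (analyticOnNhd_iterD (U := U) (fun f hf => ?_) _ (huU t ht)).differentiableAt.hasFDerivAt
        rw [List.eq_of_mem_replicate hf]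
        exact hF
      have := (hd.restrictScalars ℝ).comp_hasDerivWithinAt t (hu.2 t ht)
      have heq : iterD (List.replicate (i + 1 + 1) F) (u t) =
          fderiv ℂ (iterD (List.replicate (i + 1) F)) (u t) (F (u t)) := by
        rw [List.replicate_succ, iterD_cons (by simp)]
      show HasDerivWithinAt _ (iterD (List.replicate (i + 1 + 1) F) (u t)) _ _
      rw [heq]
      exact this

/-! ### Taylor expansion in the increments -/

/-- Cauchy's estimates for the higher derivatives of a bounded holomorphic map. -/
theorem norm_iteratedFDeriv_le {E F : Type*} [NormedAddCommGroup E] [NormedSpace ℂ E]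
    [NormedAddCommGroup F] [NormedSpace ℂ F] [CompleteSpace F] {g : E → F} {U : Set E} {σ C : ℝ}
    (hσ : 0 < σ) (hg : AnalyticOnNhd ℂ g U) (hC : ∀ w ∈ U, ‖g w‖ ≤ C) (j : ℕ) {y : E}
    (hy : Metric.ball y (j * σ) ⊆ U) (hyU : y ∈ U) : ‖iteratedFDeriv ℂ j g y‖ ≤ C / σ ^ j := by
  induction j generalizing y with
  | zero => simpa using hC y hyU
  | succ j ih =>
    have hsub : Metric.ball y σ ⊆ Metric.ball y ((j + 1 : ℕ) * σ) := by
      refine Metric.ball_subset_ball ?_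
      push_cast
      nlinarith [Nat.cast_nonneg (α := ℝ) j]
    rw [← norm_fderiv_iteratedFDeriv, pow_succ, ← div_div]
    refine norm_fderiv_le_div_of_ball hσ
      (((hg.iteratedFDeriv j).differentiableOn).mono (hsub.trans hy)) fun w hw => ?_
    refine ih ((Metric.ball_subset_ball' ?_).trans hy) (hy (hsub hw))
    have := Metric.mem_ball.1 hw
    push_cast
    linarith

theorem self_pow_le_exp_mul_factorial (j : ℕ) : (j : ℝ) ^ j ≤ Real.exp 1 ^ j * j ! := by
  have h := Real.pow_div_factorial_le_exp (j : ℝ) (Nat.cast_nonneg j) j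
  rw [div_le_iff₀ (by positivity)] at h
  rwa [← Real.exp_nat_mul, mul_one]

/-- The words of length `j` in which each letter `l` occurs `α l` times. -/
def words {n : ℕ} (j : ℕ) (α : Fin n → ℕ) : Finset (Fin j → Fin n) :=
  {s | ∀ l, #{i | s i = l} = α l}

theorem mem_words {n j : ℕ} {α : Fin n → ℕ} {s : Fin j → Fin n} :
    s ∈ words j α ↔ (fun l => #{i | s i = l}) = α := by
  simp [words, funext_iff]

theorem taylorCoeff_eq {E : Type*} [NormedAddCommGroup E] [NormedSpace ℂ E] {n j : ℕ}
    (F : (Fin n → ℂ) → E) {α : Fin n → ℕ} (hα : deg α = j) :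
    taylorCoeff F α = (j ! : ℂ)⁻¹ •
      ∑ s ∈ words j α, iteratedFDeriv ℂ j F 0 (fun i => Pi.single (s i) 1) := by
  subst hα
  rfl

theorem sum_words {M : Type*} [AddCommMonoid M] {n N j : ℕ} (hj : j ∈ Finset.Icc 1 N)
    (g : (Fin j → Fin n) → M) :
    ∑ α ∈ indexSet n N with deg α = j, ∑ s ∈ words j α, g s = ∑ s, g s := by
  have hmaps : ∀ s ∈ (Finset.univ : Finset (Fin j → Fin n)),
      (fun l => #{i | s i = l}) ∈ {α ∈ indexSet n N | deg α = j} := by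
    intro s _
    have hdeg : deg (fun l => #{i | s i = l}) = j := by
      have h := Finset.card_eq_sum_card_fiberwise (f := s) (s := Finset.univ) (t := Finset.univ)
        fun _ _ => Finset.mem_coe.2 (Finset.mem_univ _)
      rw [Finset.card_univ, Fintype.card_fin] at h
      exact h.symm
    rw [Finset.mem_filter, mem_indexSet, hdeg]
    exact ⟨Finset.mem_Icc.1 hj, rfl⟩
  rw [← Finset.sum_fiberwise_of_maps_to hmaps]
  refine Finset.sum_congr rfl fun α _ => Finset.sum_congr ?_ fun _ _ => rfl
  ext s
  rw [mem_words, Finset.mem_filter, and_iff_right (Finset.mem_univ _)]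

theorem sum_indexSet_eq {M : Type*} [AddCommMonoid M] {n N : ℕ} (g : (Fin n → ℕ) → M) :
    ∑ α ∈ indexSet n N, g α =
      ∑ j ∈ Finset.Icc 1 N, ∑ α ∈ indexSet n N with deg α = j, g α :=
  (Finset.sum_fiberwise_of_maps_to
    (fun _ hα => Finset.mem_Icc.2 (mem_indexSet.1 hα)) _).symm

theorem prod_comp_word {n j : ℕ} (x : Fin n → ℂ) {α : Fin n → ℕ} {s : Fin j → Fin n}
    (hs : s ∈ words j α) : ∏ i, x (s i) = ∏ l, x l ^ α l := by
  rw [← mem_words.1 hs, ← Finset.prod_fiberwise_of_maps_to (g := s) (t := Finset.univ)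
    fun _ _ => Finset.mem_univ _]
  refine Finset.prod_congr rfl fun l _ => ?_
  rw [Finset.prod_congr rfl fun i hi => by rw [(Finset.mem_filter.1 hi).2], Finset.prod_const]

/-- Expanding each symmetric form in the standard basis gives a sum over words; grouping words by
their letter counts recovers the multi-indices. -/
theorem sum_taylorCoeff {E : Type*} [NormedAddCommGroup E] [NormedSpace ℂ E] {n N : ℕ}
    (F : (Fin n → ℂ) → E) (x : Fin n → ℂ) :
    ∑ α ∈ indexSet n N, (∏ l, x l ^ α l) • taylorCoeff F α =
      ∑ j ∈ Finset.Icc 1 N, (j ! : ℂ)⁻¹ • iteratedFDeriv ℂ j F 0 (fun _ => x) := by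
  rw [sum_indexSet_eq]
  refine Finset.sum_congr rfl fun j hj => ?_
  have hx : (fun _ : Fin j => x) = fun _ => ∑ l, x l • (Pi.single l 1 : Fin n → ℂ) := by
    funext _
    exact pi_eq_sum_univ' x
  have hexp : iteratedFDeriv ℂ j F 0 (fun _ => x) = ∑ s : Fin j → Fin n,
      (∏ i, x (s i)) • iteratedFDeriv ℂ j F 0 (fun i => Pi.single (s i) 1) := by
    rw [hx, ContinuousMultilinearMap.map_sum]
    exact Finset.sum_congr rfl fun s _ => ContinuousMultilinearMap.map_smul_univ _ _ _
  rw [hexp, ← sum_words hj, Finset.smul_sum]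
  refine Finset.sum_congr rfl fun α hα => ?_
  rw [taylorCoeff_eq F (Finset.mem_filter.1 hα).2, smul_comm, Finset.smul_sum]
  congr 1
  exact Finset.sum_congr rfl fun s hs => by rw [prod_comp_word x hs]

theorem norm_taylorCoeff_le {E : Type*} [NormedAddCommGroup E] [NormedSpace ℂ E] {n : ℕ}
    (F : (Fin n → ℂ) → E) (α : Fin n → ℕ) :
    ‖taylorCoeff F α‖ ≤
      #(words (deg α) α) * (((deg α)! : ℝ)⁻¹ * ‖iteratedFDeriv ℂ (deg α) F 0‖) := by
  rw [taylorCoeff_eq F rfl, norm_smul, norm_inv, Complex.norm_natCast, mul_left_comm]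
  refine mul_le_mul_of_nonneg_left ?_ (by positivity)
  rw [← nsmul_eq_mul]
  refine (norm_sum_le _ _).trans (Finset.sum_le_card_nsmul _ _ _ fun s _ => ?_)
  refine (ContinuousMultilinearMap.le_opNorm _ _).trans (mul_le_of_le_one_right (norm_nonneg _) ?_)
  refine Finset.prod_le_one (fun _ _ => norm_nonneg _) fun i _ => ?_
  refine (pi_norm_le_iff_of_nonneg zero_le_one).2 fun l => ?_
  rw [Pi.single_apply]
  split_ifs <;> simp

/-- The majorants of the Taylor coefficients of a map that is bounded by `C` on a ball. -/
noncomputable def taylorBound {n : ℕ} (C r : ℝ) (α : Fin n → ℕ) : ℝ :=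
  #(words (deg α) α) * (C * (Real.exp 1 / r) ^ deg α)

/-- There are `n ^ j` words of length `j`, so degree `j` contributes `C θ^j` with `θ = q n e / r`; a
geometric series with ratio at most `1/2` is at most twice its first term. -/
theorem sum_taylorBound_le {n N : ℕ} {C r q : ℝ} (hC : 0 ≤ C) (hr : 0 < r) (hq : 0 ≤ q)
    (hθ : q * n * Real.exp 1 / r ≤ 1 / 2) :
    ∑ α ∈ indexSet n N, q ^ deg α * taylorBound C r α ≤
      2 * C * (q * n * Real.exp 1 / r) := by
  set θ := q * n * Real.exp 1 / r with hθdef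
  have hθ0 : 0 ≤ θ := by positivity
  rw [sum_indexSet_eq]
  have h1 : ∀ j ∈ Finset.Icc 1 N, ∑ α ∈ indexSet n N with deg α = j,
      q ^ deg α * taylorBound C r α = C * θ ^ j := by
    intro j hj
    have h2 : ∀ α ∈ {α ∈ indexSet n N | deg α = j}, q ^ deg α * taylorBound C r α =
        ∑ s ∈ words j α, C * (q * Real.exp 1 / r) ^ j := by
      intro α hα
      obtain rfl := (Finset.mem_filter.1 hα).2
      rw [Finset.sum_const, nsmul_eq_mul, taylorBound, mul_div_assoc, mul_pow]
      ring
    rw [Finset.sum_congr rfl h2, sum_words hj, Finset.sum_const, Finset.card_univ,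
      Fintype.card_fun, Fintype.card_fin, Fintype.card_fin, nsmul_eq_mul, hθdef, Nat.cast_pow,
      mul_left_comm, ← mul_pow]
    ring
  rw [Finset.sum_congr rfl h1, ← Finset.mul_sum]
  have h3 : ∑ j ∈ Finset.Icc 1 N, θ ^ j ≤ 2 * θ := by
    have h4 : ∑ j ∈ Finset.Icc 1 N, θ ^ j = θ * ∑ j ∈ Finset.range N, θ ^ j := by
      rw [← Finset.Ico_succ_right_eq_Icc, Finset.sum_Ico_eq_sum_range, Finset.mul_sum]
      refine Finset.sum_congr (by simp) fun j _ => ?_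
      rw [pow_add, pow_one]
    have h5 : (∑ j ∈ Finset.range N, θ ^ j) * (1 - θ) = 1 - θ ^ N := geom_sum_mul_neg θ N
    have h6 : 0 ≤ ∑ j ∈ Finset.range N, θ ^ j := Finset.sum_nonneg fun _ _ => by positivity
    have h7 : 0 ≤ θ ^ N := by positivity
    rw [h4, mul_comm 2]
    refine mul_le_mul_of_nonneg_left ?_ hθ0
    nlinarith
  nlinarith

section Bounded

variable {E : Type*} [NormedAddCommGroup E] [NormedSpace ℂ E] [CompleteSpace E] {n : ℕ}
  {F : (Fin n → ℂ) → E} {a : E} {r C : ℝ}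

theorem norm_iteratedFDeriv_le_of_ball (hr : 0 < r)
    (hF : AnalyticOnNhd ℂ F (Metric.ball 0 (r + r)))
    (hC : ∀ x ∈ Metric.ball (0 : Fin n → ℂ) (r + r), ‖F x - a‖ ≤ C) {j : ℕ} (hj : 1 ≤ j)
    {x : Fin n → ℂ} (hx : x ∈ Metric.ball 0 r) : ‖iteratedFDeriv ℂ j F x‖ ≤ C * (j / r) ^ j := by
  have hx' : x ∈ Metric.ball (0 : Fin n → ℂ) (r + r) := Metric.ball_subset_ball (by linarith) hx
  have hj' : (0 : ℝ) < j := by exact_mod_cast hj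
  have heq : iteratedFDeriv ℂ j F x = iteratedFDeriv ℂ j (fun x => F x - a) x := by
    have h := iteratedFDeriv_sub_apply (i := j) (x := x) (f := F) (g := fun _ => a)
      (hF x hx').contDiffAt contDiffAt_const
    rw [iteratedFDeriv_const_of_ne (by omega)] at h
    simpa [Pi.sub_def] using h.symm
  rw [heq]
  -- The `j` Cauchy steps share the available radius `r` equally; `j ^ j` is later traded for `e ^ j
  -- * j!`.
  refine (norm_iteratedFDeriv_le (σ := r / j) (by positivity)
    (fun x hx => (hF x hx).sub analyticAt_const) hC j ?_ hx').trans_eq ?_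
  · rw [mul_div_cancel₀ _ hj'.ne']
    exact Metric.ball_subset_ball' (by have := Metric.mem_ball.1 hx; linarith)
  · rw [div_eq_mul_inv, ← inv_pow, inv_div]

theorem norm_taylorCoeff_le_taylorBound (hr : 0 < r)
    (hF : AnalyticOnNhd ℂ F (Metric.ball 0 (r + r)))
    (hC : ∀ x ∈ Metric.ball (0 : Fin n → ℂ) (r + r), ‖F x - a‖ ≤ C) {α : Fin n → ℕ}
    (hα : 1 ≤ deg α) : ‖taylorCoeff F α‖ ≤ taylorBound C r α := by
  have hC0 : 0 ≤ C := (norm_nonneg _).trans (hC 0 (Metric.mem_ball_self (by linarith)))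
  refine (norm_taylorCoeff_le F α).trans (mul_le_mul_of_nonneg_left ?_ (by positivity))
  have h1 := norm_iteratedFDeriv_le_of_ball hr hF hC hα (Metric.mem_ball_self hr)
  have h2 := self_pow_le_exp_mul_factorial (deg α)
  rw [inv_mul_le_iff₀ (by positivity)]
  refine h1.trans ?_
  rw [mul_left_comm, div_pow, div_pow]
  refine mul_le_mul_of_nonneg_left ?_ hC0
  rw [mul_div_assoc', mul_comm _ (Real.exp 1 ^ _)]
  gcongr

theorem norm_sub_sum_taylorCoeff_le (hr : 0 < r)
    (hF : AnalyticOnNhd ℂ F (Metric.ball 0 (r + r)))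
    (hC : ∀ x ∈ Metric.ball (0 : Fin n → ℂ) (r + r), ‖F x - a‖ ≤ C) [NormedSpace ℝ E]
    [IsScalarTower ℝ ℂ E] {x : Fin n → ℂ} {ρ : ℝ} (hρ0 : 0 ≤ ρ) (hρ : ρ < r)
    (hx : ∀ l, ‖x l‖ ≤ ρ) (N : ℕ) :
    ‖F x - (F 0 + ∑ α ∈ indexSet n N, (∏ l, x l ^ α l) • taylorCoeff F α)‖ ≤
      C * (2 * Real.exp 1 * ρ / r) ^ (N + 1) := by
  have hC0 : 0 ≤ C := (norm_nonneg _).trans (hC 0 (Metric.mem_ball_self (by linarith)))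
  have hxρ : ‖x‖ ≤ ρ := (pi_norm_le_iff_of_nonneg hρ0).2 hx
  have hmem : ∀ t ∈ Set.Icc (0 : ℝ) 1, t • x ∈ Metric.ball (0 : Fin n → ℂ) r := by
    intro t ht
    rw [mem_ball_zero_iff, norm_smul, Real.norm_of_nonneg ht.1]
    nlinarith [ht.1, ht.2, norm_nonneg x]
  have hmem' : ∀ t ∈ Set.Icc (0 : ℝ) 1, t • x ∈ Metric.ball (0 : Fin n → ℂ) (r + r) := fun t ht =>
    Metric.ball_subset_ball (by linarith) (hmem t ht)
  have h := norm_sub_taylor_le (N := N)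
    (G := fun i t => iteratedFDeriv ℂ i F (t • x) fun _ => x)
    (C := C * ((N + 1 : ℕ) / r) ^ (N + 1) * ρ ^ (N + 1)) (fun i t ht => ?_) fun t ht => ?_
  · rw [Finset.sum_range_succ'] at h
    simp only [Nat.factorial_zero, Nat.cast_one, inv_one, one_smul, iteratedFDeriv_zero_apply,
      zero_smul] at h
    have hsum : ∑ j ∈ Finset.Icc 1 N, (j ! : ℂ)⁻¹ • iteratedFDeriv ℂ j F 0 (fun _ => x) =
        ∑ i ∈ Finset.range N, ((i + 1)! : ℝ)⁻¹ • iteratedFDeriv ℂ (i + 1) F 0 fun _ => x := by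
      rw [← Finset.Ico_succ_right_eq_Icc, Finset.sum_Ico_eq_sum_range]
      refine Finset.sum_congr (by simp) fun i _ => ?_
      rw [add_comm 1 i, inv_natCast_smul_eq ℂ ℝ]
    rw [sum_taylorCoeff, hsum, add_comm (F 0)]
    refine h.trans ?_
    rw [div_le_iff₀ (by positivity)]
    have h2 := self_pow_le_exp_mul_factorial (N + 1)
    -- The remainder carries `N!` where `(N + 1)!` would match; the surplus factor `N + 1` is
    -- absorbed into the base, whence the `2` in the statement.
    have h3 : ((N + 1 : ℕ) : ℝ) ≤ 2 ^ (N + 1) := by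
      exact_mod_cast Nat.lt_two_pow_self.le
    have h4 : ((N + 1 : ℕ) : ℝ) ^ (N + 1) ≤ (2 * Real.exp 1) ^ (N + 1) * N ! := by
      refine h2.trans ?_
      rw [Nat.factorial_succ, Nat.cast_mul, mul_pow]
      calc Real.exp 1 ^ (N + 1) * (((N + 1 : ℕ) : ℝ) * N !)
          = ((N + 1 : ℕ) : ℝ) * (Real.exp 1 ^ (N + 1) * N !) := by ring
        _ ≤ 2 ^ (N + 1) * (Real.exp 1 ^ (N + 1) * N !) := by gcongr
        _ = _ := by ring
    calc C * ((N + 1 : ℕ) / r) ^ (N + 1) * ρ ^ (N + 1)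
        = C * ρ ^ (N + 1) / r ^ (N + 1) * ((N + 1 : ℕ) : ℝ) ^ (N + 1) := by rw [div_pow]; ring
      _ ≤ C * ρ ^ (N + 1) / r ^ (N + 1) * ((2 * Real.exp 1) ^ (N + 1) * N !) := by gcongr
      _ = C * (2 * Real.exp 1 * ρ / r) ^ (N + 1) * N ! := by
        rw [div_pow, mul_pow _ ρ]; ring
  · have h1 : HasFDerivAt (iteratedFDeriv ℂ i F) (fderiv ℂ (iteratedFDeriv ℂ i F) (t • x)) (t • x) :=
      (hF.iteratedFDeriv i _ (hmem' t ht)).differentiableAt.hasFDerivAt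
    have h2 : HasDerivWithinAt (fun t : ℝ => t • x) x (Set.Icc 0 1) t := by
      simpa using ((hasDerivAt_id t).smul_const x).hasDerivWithinAt
    have h3 := (h1.restrictScalars ℝ).comp_hasDerivWithinAt t h2
    have h4 := (((ContinuousMultilinearMap.apply ℂ (fun _ : Fin i => Fin n → ℂ) E
      fun _ => x).hasFDerivAt (x := iteratedFDeriv ℂ i F (t • x))).restrictScalars
        ℝ).comp_hasDerivWithinAt t h3
    have h5 : iteratedFDeriv ℂ (i + 1) F (t • x) (fun _ => x) =
        (fderiv ℂ (iteratedFDeriv ℂ i F) (t • x) x) fun _ => x := by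
      rw [iteratedFDeriv_succ_apply_left]; rfl
    rw [h5]
    exact h4
  · refine (ContinuousMultilinearMap.le_opNorm _ _).trans ?_
    rw [Finset.prod_const, Finset.card_univ, Fintype.card_fin]
    gcongr
    exact norm_iteratedFDeriv_le_of_ball hr hF hC (by omega) (hmem t ht)

end Bounded

/-- The Taylor coefficients in the first variable of a jointly analytic map are analytic in the
second variable. -/
theorem analyticOnNhd_taylorCoeff {E F : Type*} [NormedAddCommGroup E] [NormedSpace ℂ E]
    [NormedAddCommGroup F] [NormedSpace ℂ F] [CompleteSpace F] {n : ℕ}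
    {G : (Fin n → ℂ) × E → F} {W : Set ((Fin n → ℂ) × E)} (hW : IsOpen W)
    (hG : AnalyticOnNhd ℂ G W) {U : Set E} (hU : ∀ y ∈ U, ((0 : Fin n → ℂ), y) ∈ W)
    (α : Fin n → ℕ) : AnalyticOnNhd ℂ (fun y => taylorCoeff (fun x => G (x, y)) α) U := by
  have hpart : ∀ (j : ℕ) (y : E), (0, y) ∈ W → ∀ v : Fin j → Fin n → ℂ,
      iteratedFDeriv ℂ j (fun x => G (x, y)) 0 v = iteratedFDeriv ℂ j G (0, y) fun i => (v i, 0) := by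
    intro j y hy v
    -- After this translation the slice at `y` is the composition with the linear inclusion of the
    -- first factor, so partial derivatives are restrictions of full ones.
    set g : (Fin n → ℂ) × E → F := fun p => G (p + (0, y)) with hg
    set s : Set ((Fin n → ℂ) × E) := (fun p => p + (0, y)) ⁻¹' W with hs
    have hso : IsOpen s := hW.preimage (by fun_prop)
    have hgs : ContDiffOn ℂ j g s := fun p hp =>
      ((hG (p + (0, y)) hp).contDiffAt.comp p (by fun_prop)).contDiffWithinAt
    have h0 : ContinuousLinearMap.inl ℂ (Fin n → ℂ) E 0 ∈ s := by
      simpa [hs] using hy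
    have hpo : IsOpen (ContinuousLinearMap.inl ℂ (Fin n → ℂ) E ⁻¹' s) :=
      hso.preimage (ContinuousLinearMap.continuous _)
    have h := ContinuousLinearMap.iteratedFDerivWithin_comp_right
      (ContinuousLinearMap.inl ℂ (Fin n → ℂ) E) hgs hso.uniqueDiffOn hpo.uniqueDiffOn h0 le_rfl
    rw [iteratedFDerivWithin_of_isOpen j hpo (show (0 : Fin n → ℂ) ∈ _ from h0),
      iteratedFDerivWithin_of_isOpen j hso h0] at h
    have hcomp : g ∘ ContinuousLinearMap.inl ℂ (Fin n → ℂ) E = fun x => G (x, y) := by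
      funext x
      simp [hg]
    rw [hcomp] at h
    rw [h, hg, iteratedFDeriv_comp_add_right]
    simp [ContinuousMultilinearMap.compContinuousLinearMap_apply]
  intro y hy
  have hev : (fun y => taylorCoeff (fun x => G (x, y)) α) =ᶠ[nhds y] fun y =>
      ((deg α)! : ℂ)⁻¹ • ∑ s ∈ words (deg α) α,
        iteratedFDeriv ℂ (deg α) G (0, y) fun i => (Pi.single (s i) 1, 0) := by
    have hnhds : ∀ᶠ y' in nhds y, ((0 : Fin n → ℂ), y') ∈ W :=
      (hW.preimage (f := fun y' => ((0 : Fin n → ℂ), y')) (by fun_prop)).mem_nhds (hU y hy)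
    filter_upwards [hnhds] with y' hy'
    rw [taylorCoeff_eq _ rfl]
    congr 1
    exact Finset.sum_congr rfl fun s _ => hpart _ _ hy' _
  refine AnalyticAt.congr ?_ hev.symm
  refine AnalyticAt.fun_smul analyticAt_const (Finset.analyticAt_fun_sum _ fun s _ => ?_)
  have h1 : AnalyticAt ℂ (fun y' => iteratedFDeriv ℂ (deg α) G (0, y')) y :=
    (hG.iteratedFDeriv (deg α) _ (hU y hy)).comp_of_eq (analyticAt_const.prod analyticAt_id) rfl
  exact ((ContinuousMultilinearMap.apply ℂ (fun _ : Fin (deg α) => (Fin n → ℂ) × E) F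
    fun i => (Pi.single (s i) 1, 0)).analyticAt _).comp h1

/-! ### Existence, uniqueness and analyticity of the Runge–Kutta stages -/

/-- The map whose fixed points in the domain are the stage vectors of the Runge–Kutta step. -/
noncomputable def stageMap {E : Type*} [NormedAddCommGroup E] [NormedSpace ℂ E] {n s : ℕ}
    (a : Fin s → Fin s → ℝ) (V : Fin n → E → E) (x : Fin n → ℂ) (y : E) (g : Fin s → E) :
    Fin s → E :=
  fun i => y + ∑ j, (a i j : ℂ) • ∑ l, x l • V l (g j)

/-- Holomorphic vector fields, bounded by `M` on the ball of radius `2R` around `z`, and a bound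
`κ` for the row sums of a Runge–Kutta matrix. -/
structure BoundedFields {E : Type*} [NormedAddCommGroup E] [NormedSpace ℂ E] {n s : ℕ}
    (a : Fin s → Fin s → ℝ) (V : Fin n → E → E) (z : E) (R M κ : ℝ) : Prop where
  radius_pos : 0 < R
  bound_nonneg : 0 ≤ M
  rowSum_nonneg : 0 ≤ κ
  rowSum_le : ∀ i, ∑ j, |a i j| ≤ κ
  analytic : ∀ l, AnalyticOnNhd ℂ (V l) (Metric.closedBall z (2 * R))
  norm_le : ∀ l, ∀ y ∈ Metric.closedBall z (2 * R), ‖V l y‖ ≤ M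

theorem norm_sum_smul_le {E ι : Type*} [NormedAddCommGroup E] [NormedSpace ℂ E] (t : Finset ι)
    {c : ι → ℝ} {v : ι → E} {B κ : ℝ} (hB : 0 ≤ B) (hκ : ∑ j ∈ t, |c j| ≤ κ)
    (hv : ∀ j ∈ t, ‖v j‖ ≤ B) : ‖∑ j ∈ t, (c j : ℂ) • v j‖ ≤ κ * B := by
  refine (norm_sum_le _ _).trans ?_
  calc ∑ j ∈ t, ‖(c j : ℂ) • v j‖ ≤ ∑ j ∈ t, |c j| * B := by
        refine Finset.sum_le_sum fun j hj => ?_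
        rw [norm_smul, Complex.norm_real, Real.norm_eq_abs]
        exact mul_le_mul_of_nonneg_left (hv j hj) (abs_nonneg _)
    _ = (∑ j ∈ t, |c j|) * B := by rw [Finset.sum_mul]
    _ ≤ κ * B := mul_le_mul_of_nonneg_right hκ hB

theorem norm_sum_incr_smul_le {E : Type*} [NormedAddCommGroup E] [NormedSpace ℂ E] {n : ℕ}
    (x : Fin n → ℂ) {v : Fin n → E} {B : ℝ} (hv : ∀ l, ‖v l‖ ≤ B) :
    ‖∑ l, x l • v l‖ ≤ n * ‖x‖ * B := by
  refine (norm_sum_le _ _).trans ?_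
  calc ∑ l, ‖x l • v l‖ ≤ ∑ _l : Fin n, ‖x‖ * B := by
        refine Finset.sum_le_sum fun l _ => ?_
        rw [norm_smul]
        exact mul_le_mul (norm_le_pi_norm x l) (hv l) (norm_nonneg _) (norm_nonneg _)
    _ = n * ‖x‖ * B := by simp [mul_assoc]

theorem isRKStages_iff {E : Type*} [NormedAddCommGroup E] [NormedSpace ℂ E] {n s : ℕ}
    {a : Fin s → Fin s → ℝ} {V : Fin n → E → E} {S : Set E} {x : Fin n → ℂ} {y : E}
    {g : Fin s → E} :
    IsRKStages a V S x y g ↔ (∀ i, g i ∈ S) ∧ stageMap a V x y g = g := by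
  simp only [IsRKStages, stageMap, forall_and, funext_iff]
  exact and_congr_right fun _ => forall_congr' fun _ => eq_comm

theorem rkStep_zero {E : Type*} [NormedAddCommGroup E] [NormedSpace ℂ E] {n s : ℕ}
    (a : Fin s → Fin s → ℝ) (b : Fin s → ℝ) (V : Fin n → E → E) (S : Set E) (y : E) :
    rkStep a b V S 0 y = y := by
  simp [rkStep]

namespace BoundedFields

section

variable {E : Type*} [NormedAddCommGroup E] [NormedSpace ℂ E] {n s : ℕ}
  {a : Fin s → Fin s → ℝ} {V : Fin n → E → E} {z : E} {R M κ : ℝ}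

theorem norm_stageMap_sub_le (H : BoundedFields a V z R M κ) {x : Fin n → ℂ} {y : E}
    {g : Fin s → E} (hg : ∀ i, g i ∈ Metric.closedBall z (2 * R)) (i : Fin s) :
    ‖stageMap a V x y g i - y‖ ≤ κ * (n * ‖x‖ * M) := by
  rw [stageMap, add_sub_cancel_left]
  have := H.bound_nonneg
  exact norm_sum_smul_le _ (by positivity) (H.rowSum_le i) fun j _ =>
    norm_sum_incr_smul_le x fun l => H.norm_le l _ (hg j)

theorem norm_field_sub_le [NormedSpace ℝ E] (H : BoundedFields a V z R M κ) (l : Fin n)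
    {y y' : E} (hy : y ∈ Metric.closedBall z (7 / 4 * R))
    (hy' : y' ∈ Metric.closedBall z (7 / 4 * R)) : ‖V l y - V l y'‖ ≤ 4 * M / R * ‖y - y'‖ := by
  have hR := H.radius_pos
  have hsub : Metric.ball z (7 / 4 * R + R / 4) ⊆ Metric.closedBall z (2 * R) :=
    (Metric.ball_subset_ball (by linarith)).trans Metric.ball_subset_closedBall
  have h := lipschitzOnWith_closedBall (B := M.toNNReal) (g := V l) (z := z)
    (r := 7 / 4 * R) (σ := R / 4) (by positivity)
    ((H.analytic l).differentiableOn.mono hsub) (fun w hw => (H.norm_le l w (hsub hw)).trans (Real.le_coe_toNNReal M))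
  have h2 := h.norm_sub_le hy hy'
  rw [NNReal.coe_div, Real.coe_toNNReal _ H.bound_nonneg,
    Real.coe_toNNReal _ (by positivity)] at h2
  refine h2.trans_eq ?_
  field_simp

/-- Between radii `7/4 R` and `2R` Cauchy's estimate makes the fields Lipschitz with constant
`4M/R`; the smallness `R/8` turns this into `1/2`. -/
theorem lipschitz_stageMap [NormedSpace ℝ E] (H : BoundedFields a V z R M κ) {x : Fin n → ℂ}
    (hx : κ * (n * ‖x‖ * M) ≤ R / 8) (y : E) :
    LipschitzOnWith (1 / 2) (stageMap a V x y) {g | ∀ i, g i ∈ Metric.closedBall z (7 / 4 * R)} := by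
  have hR := H.radius_pos
  have hM := H.bound_nonneg
  have hκ := H.rowSum_nonneg
  refine LipschitzOnWith.of_dist_le_mul fun g hg g' hg' => ?_
  rw [dist_eq_norm, dist_eq_norm, NNReal.coe_div, NNReal.coe_one, NNReal.coe_ofNat]
  refine (pi_norm_le_iff_of_nonneg (by positivity)).2 fun i => ?_
  have heq : (stageMap a V x y g - stageMap a V x y g') i =
      ∑ j, (a i j : ℂ) • ∑ l, x l • (V l (g j) - V l (g' j)) := by
    simp only [stageMap, Pi.sub_apply, add_sub_add_left_eq_sub, smul_sub, Finset.sum_sub_distrib]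
  rw [heq]
  have h1 : ∀ j ∈ Finset.univ, ‖∑ l, x l • (V l (g j) - V l (g' j))‖ ≤
      n * ‖x‖ * (4 * M / R * ‖g - g'‖) := fun j _ =>
    norm_sum_incr_smul_le x fun l => (H.norm_field_sub_le l (hg j) (hg' j)).trans
      (mul_le_mul_of_nonneg_left (norm_le_pi_norm (g - g') j) (by positivity))
  refine (norm_sum_smul_le _ (by positivity) (H.rowSum_le i) h1).trans ?_
  calc κ * (n * ‖x‖ * (4 * M / R * ‖g - g'‖))
      = κ * (n * ‖x‖ * M) * (4 / R * ‖g - g'‖) := by ring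
    _ ≤ R / 8 * (4 / R * ‖g - g'‖) := by gcongr
    _ = 1 / 2 * ‖g - g'‖ := by field_simp; ring

/-- Since `3/2 + 1/8 < 7/4`, stages allowed anywhere in the `2R`-ball lie where the stage map
contracts. This extends uniqueness to the whole domain. -/
theorem stages_mem (H : BoundedFields a V z R M κ) {x : Fin n → ℂ}
    (hx : κ * (n * ‖x‖ * M) ≤ R / 8) {y : E} (hy : y ∈ Metric.ball z (3 / 2 * R))
    {g : Fin s → E} (hg : IsRKStages a V (Metric.closedBall z (2 * R)) x y g) (i : Fin s) :
    g i ∈ Metric.ball z (7 / 4 * R) := by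
  have hR := H.radius_pos
  obtain ⟨h1, h2⟩ := isRKStages_iff.1 hg
  have h3 := H.norm_stageMap_sub_le (x := x) (y := y) h1 i
  rw [h2, ← dist_eq_norm] at h3
  have := Metric.mem_ball.1 hy
  rw [Metric.mem_ball]
  linarith [dist_triangle (g i) y z]

theorem existsUnique_isRKStages [CompleteSpace E] [NormedSpace ℝ E]
    (H : BoundedFields a V z R M κ) {x : Fin n → ℂ}
    (hx : κ * (n * ‖x‖ * M) ≤ R / 8) {y : E} (hy : y ∈ Metric.ball z (3 / 2 * R)) :
    ∃! g : Fin s → E, IsRKStages a V (Metric.closedBall z (2 * R)) x y g := by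
  have hR := H.radius_pos
  have hy' := Metric.mem_ball.1 hy
  have hL := H.lipschitz_stageMap hx y
  have hball : ∀ g ∈ Metric.closedBall (fun _ : Fin s => y) (R / 8),
      ∀ i, g i ∈ Metric.closedBall z (7 / 4 * R) := by
    intro g hg i
    have := (dist_pi_le_iff (by positivity)).1 (Metric.mem_closedBall.1 hg) i
    rw [Metric.mem_closedBall]
    linarith [dist_triangle (g i) y z]
  have hball2 : Metric.closedBall z (7 / 4 * R) ⊆ Metric.closedBall z (2 * R) :=
    Metric.closedBall_subset_closedBall (by linarith)
  have hmaps : Set.MapsTo (stageMap a V x y) (Metric.closedBall (fun _ : Fin s => y) (R / 8))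
      (Metric.closedBall (fun _ : Fin s => y) (R / 8)) := by
    intro g hg
    refine Metric.mem_closedBall.2 ((dist_pi_le_iff (by positivity)).2 fun i => ?_)
    rw [dist_eq_norm]
    exact (H.norm_stageMap_sub_le (fun i => hball2 (hball g hg i)) i).trans hx
  have hcontr : ContractingWith (1 / 2) (hmaps.restrict (stageMap a V x y) _ _) :=
    ⟨by rw [← NNReal.coe_lt_coe]; norm_num, ((hL.mono hball).mapsToRestrict hmaps)⟩
  obtain ⟨g, hg, hfix, -⟩ := hcontr.exists_fixedPoint' Metric.isClosed_closedBall.isComplete hmaps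
    (Metric.mem_closedBall_self (by positivity)) (edist_ne_top _ _)
  refine ⟨g, isRKStages_iff.2 ⟨fun i => hball2 (hball g hg i), hfix⟩, fun g' hg' => ?_⟩
  have hd := hL.dist_le_mul g'
    (fun i => Metric.ball_subset_closedBall (H.stages_mem hx hy hg' i)) g (hball g hg)
  rw [(isRKStages_iff.1 hg').2, show stageMap a V x y g = g from hfix] at hd
  rw [NNReal.coe_div, NNReal.coe_one, NNReal.coe_ofNat] at hd
  exact dist_le_zero.1 (by linarith [dist_nonneg (x := g') (y := g)])

theorem isRKStages_rkStages [CompleteSpace E] [NormedSpace ℝ E]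
    (H : BoundedFields a V z R M κ) {x : Fin n → ℂ}
    (hx : κ * (n * ‖x‖ * M) ≤ R / 8) {y : E} (hy : y ∈ Metric.ball z (3 / 2 * R)) :
    IsRKStages a V (Metric.closedBall z (2 * R)) x y
      (rkStages a V (Metric.closedBall z (2 * R)) x y) :=
  Classical.epsilon_spec (H.existsUnique_isRKStages hx hy).exists

theorem norm_rkStep_sub_le [CompleteSpace E] [NormedSpace ℝ E]
    (H : BoundedFields a V z R M κ) {b : Fin s → ℝ} {μ : ℝ} (hμ : ∑ i, |b i| ≤ μ) {x : Fin n → ℂ}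
    (hx : κ * (n * ‖x‖ * M) ≤ R / 8) {y : E} (hy : y ∈ Metric.ball z (3 / 2 * R)) :
    ‖rkStep a b V (Metric.closedBall z (2 * R)) x y - y‖ ≤ μ * (n * ‖x‖ * M) := by
  rw [rkStep, add_sub_cancel_left]
  have := H.bound_nonneg
  exact norm_sum_smul_le _ (by positivity) hμ fun i _ =>
    norm_sum_incr_smul_le x fun l =>
      H.norm_le l _ (H.isRKStages_rkStages hx hy i).1

end

section Analytic

open scoped ContDiff

variable {E : Type*} [NormedAddCommGroup E] [NormedSpace ℂ E] [CompleteSpace E]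
  {n s : ℕ} {a : Fin s → Fin s → ℝ} {V : Fin n → E → E} {z : E} {R M κ : ℝ}

theorem contDiffAt_stageMap (H : BoundedFields a V z R M κ)
    {u : ((Fin n → ℂ) × E) × (Fin s → E)} (hu : ∀ i, u.2 i ∈ Metric.closedBall z (2 * R)) :
    ContDiffAt ℂ ω (fun p : ((Fin n → ℂ) × E) × (Fin s → E) => stageMap a V p.1.1 p.1.2 p.2) u := by
  refine contDiffAt_pi.2 fun i => ?_
  refine ContDiffAt.add (by fun_prop) (ContDiffAt.sum fun j _ => contDiffAt_const.smul
    (ContDiffAt.sum fun l _ => ContDiffAt.smul (by fun_prop) ?_))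
  have hV : ContDiffAt ℂ ω (V l) (u.2 j) := (H.analytic l _ (hu j)).contDiffAt
  exact hV.comp u (by fun_prop)

/-- The partial derivative of the stage equation is `1 - A` with `‖A‖ ≤ 1/2`, invertible by the
Neumann series, so the implicit function theorem gives an analytic branch. Uniqueness of stages
identifies it with the chosen `rkStages` nearby. -/
theorem analyticAt_rkStages [NormedSpace ℝ E] (H : BoundedFields a V z R M κ)
    {p : (Fin n → ℂ) × E} (hx : κ * (n * ‖p.1‖ * M) < R / 8)
    (hy : p.2 ∈ Metric.ball z (3 / 2 * R)) :
    AnalyticAt ℂ (fun p : (Fin n → ℂ) × E =>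
      rkStages a V (Metric.closedBall z (2 * R)) p.1 p.2) p := by
  have hR := H.radius_pos
  set S := Metric.closedBall z (2 * R) with hS
  set g := rkStages a V S p.1 p.2 with hg
  have hst := H.isRKStages_rkStages hx.le hy
  have hmem := H.stages_mem hx.le hy hst
  set f : ((Fin n → ℂ) × E) × (Fin s → E) → (Fin s → E) :=
    fun q => q.2 - stageMap a V q.1.1 q.1.2 q.2 with hf
  have hcd : ContDiffAt ℂ ω f (p, g) :=
    contDiffAt_snd.sub (H.contDiffAt_stageMap fun i => (hst i).1)
  have hf0 : f (p, g) = 0 := sub_eq_zero.2 (isRKStages_iff.1 hst).2.symm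
  set A := fderiv ℂ (stageMap a V p.1 p.2) g with hA
  have hAdiff : DifferentiableAt ℂ (stageMap a V p.1 p.2) g :=
    ((H.contDiffAt_stageMap (u := (p, g)) fun i => (hst i).1).differentiableAt (by simp)).comp g
      ((differentiableAt_const p).prodMk differentiableAt_id)
  have hAnorm : ‖A‖ < 1 := by
    have hopen : IsOpen {g : Fin s → E | ∀ i, g i ∈ Metric.ball z (7 / 4 * R)} := by
      simp only [Set.ofPred_forall]
      exact isOpen_iInter_of_finite fun i => Metric.isOpen_ball.preimage (continuous_apply i)
    have := norm_fderiv_le_of_lipschitzOn ℂ (hopen.mem_nhds hmem)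
      ((H.lipschitz_stageMap hx.le p.2).mono fun g hg i => Metric.ball_subset_closedBall (hg i))
    refine this.trans_lt ?_
    rw [NNReal.coe_div, NNReal.coe_one, NNReal.coe_ofNat]
    norm_num
  have hpartial : fderiv ℂ f (p, g) ∘L .inr ℂ ((Fin n → ℂ) × E) (Fin s → E) = 1 - A := by
    have h1 : HasFDerivAt (fun g' => f (p, g'))
        (fderiv ℂ f (p, g) ∘L .inr ℂ ((Fin n → ℂ) × E) (Fin s → E)) g :=
      (hcd.differentiableAt (by simp)).hasFDerivAt.comp g (hasFDerivAt_prodMk_right p g)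
    have h2 : HasFDerivAt (fun g' => f (p, g')) (1 - A) g :=
      (hasFDerivAt_id g).sub hAdiff.hasFDerivAt
    exact h1.unique h2
  have hinv : (fderiv ℂ f (p, g) ∘L .inr ℂ ((Fin n → ℂ) × E) (Fin s → E)).IsInvertible := by
    rw [hpartial]
    obtain ⟨v, hv⟩ := isUnit_one_sub_of_norm_lt_one hAnorm
    exact ⟨ContinuousLinearEquiv.ofUnit v, by rw [← hv]; rfl⟩
  have hω : (ω : WithTop ℕ∞) ≠ 0 := by simp
  set ψ := hcd.implicitFunction hω hinv with hψ
  have hψcd : ContDiffAt ℂ ω ψ p := hcd.contDiffAt_implicitFunction hω hinv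
  have hψp : ψ p = g := hcd.implicitFunction_apply_self hω hinv
  have hψeq : ∀ᶠ q in nhds p, f (q, ψ q) = 0 := by
    have := hcd.eventually_apply_implicitFunction hω hinv
    rwa [hf0] at this
  refine hψcd.analyticAt.congr ?_
  have hev1 : ∀ᶠ q in nhds p, ∀ i, ψ q i ∈ Metric.ball z (7 / 4 * R) := by
    refine Filter.eventually_all.2 fun i => ?_
    have hc : ContinuousAt (fun q => ψ q i) p :=
      (continuous_apply i).continuousAt.comp hψcd.continuousAt
    refine hc.eventually_mem (Metric.isOpen_ball.mem_nhds ?_)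
    rw [hψp]
    exact hmem i
  have hev2 : ∀ᶠ q in nhds p, κ * (n * ‖q.1‖ * M) < R / 8 := by
    have hc : Continuous fun q : (Fin n → ℂ) × E => κ * (n * ‖q.1‖ * M) := by fun_prop
    exact hc.continuousAt.eventually_lt continuousAt_const hx
  have hev3 : ∀ᶠ q in nhds p, q.2 ∈ Metric.ball z (3 / 2 * R) :=
    continuous_snd.continuousAt.eventually_mem (Metric.isOpen_ball.mem_nhds hy)
  filter_upwards [hψeq, hev1, hev2, hev3] with q hq1 hq2 hq3 hq4
  refine (H.existsUnique_isRKStages hq3.le hq4).unique ?_ (H.isRKStages_rkStages hq3.le hq4)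
  refine isRKStages_iff.2 ⟨fun i => ?_, (sub_eq_zero.1 hq1).symm⟩
  exact Metric.closedBall_subset_closedBall (by linarith) (Metric.ball_subset_closedBall (hq2 i))

theorem analyticAt_rkStep [NormedSpace ℝ E] (H : BoundedFields a V z R M κ) (b : Fin s → ℝ)
    {p : (Fin n → ℂ) × E} (hx : κ * (n * ‖p.1‖ * M) < R / 8)
    (hy : p.2 ∈ Metric.ball z (3 / 2 * R)) :
    AnalyticAt ℂ (fun p : (Fin n → ℂ) × E =>
      rkStep a b V (Metric.closedBall z (2 * R)) p.1 p.2) p := by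
  have hst := (H.analyticAt_rkStages hx hy).contDiffAt (n := ω)
  have hmem := fun i => (H.isRKStages_rkStages hx.le hy i).1
  refine ContDiffAt.analyticAt (ContDiffAt.add contDiffAt_snd (ContDiffAt.sum fun i _ =>
    contDiffAt_const.smul (ContDiffAt.sum fun l _ => ContDiffAt.smul (by fun_prop) ?_)))
  have hV : ContDiffAt ℂ ω (V l) (rkStages a V (Metric.closedBall z (2 * R)) p.1 p.2 i) :=
    (H.analytic l _ (hmem i)).contDiffAt
  exact hV.comp p (contDiffAt_pi.1 hst i)

end Analytic

end BoundedFields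

/-! ### The modified equation over one step -/

/-- The truncated modified field of unit time step, for complex increments `x`. -/
noncomputable def unitField {E : Type*} [NormedAddCommGroup E] [NormedSpace ℂ E] {n : ℕ}
    (f : (Fin n → ℕ) → E → E) (N : ℕ) (x : Fin n → ℂ) (y : E) : E :=
  ∑ α ∈ indexSet n N, (∏ l, x l ^ α l) • f α y

theorem smul_truncField {E : Type*} [NormedAddCommGroup E] [NormedSpace ℂ E] {d : ℕ}
    (f : (Fin (d + 1) → ℕ) → E → E) (N : ℕ) {h : ℝ} (hh : h ≠ 0) (Δ : Fin d → ℝ) (y : E) :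
    (h : ℂ) • truncField f N h Δ y = unitField f N (incrVec h Δ) y := by
  rw [truncField, unitField, Finset.smul_sum]
  refine Finset.sum_congr rfl fun α _ => ?_
  rw [smul_smul]
  congr 1
  rw [Fin.prod_univ_succ]
  simp only [incrVec, Fin.cons_zero, Fin.cons_succ]
  rw [zpow_sub_one₀ hh]
  push_cast
  rw [zpow_natCast]
  have : (h : ℂ) ≠ 0 := by exact_mod_cast hh
  field_simp

theorem IsSolution.comp_mul {E : Type*} [NormedAddCommGroup E] [NormedSpace ℝ E] {F G : E → E}
    {h k : ℝ} {z : E} {u : ℝ → E} (hh : 0 < h) (hFG : ∀ y, F y = h • G y)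
    (hu : IsSolution G (h * k) z u) : IsSolution F k z fun t => u (h * t) := by
  refine ⟨by simpa using hu.1, fun t ht => ?_⟩
  have hmaps : Set.MapsTo (fun t => h * t) (Set.Icc 0 k) (Set.Icc 0 (h * k)) := fun t ht =>
    ⟨mul_nonneg hh.le ht.1, mul_le_mul_of_nonneg_left ht.2 hh.le⟩
  have h1 : HasDerivWithinAt (fun t => h * t) h (Set.Icc 0 k) t := by
    simpa using ((hasDerivAt_id t).const_mul h).hasDerivWithinAt
  rw [hFG]
  exact (hu.2 _ (hmaps ht)).scomp t h1 hmaps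

section

variable {E : Type*} [NormedAddCommGroup E] [NormedSpace ℂ E] [CompleteSpace E] [NormedSpace ℝ E]
  [IsScalarTower ℝ ℂ E]

/-- The modified equation over one step of unit length, for a map `Φ` that is close to the
identity: the solution reproduces `Φ` up to an error that is exponentially small in `N`. -/
theorem exists_unitField_isSolution {n N : ℕ} {Φ : (Fin n → ℂ) → E → E} {z : E} {R r C ρ : ℝ}
    (hn : 1 ≤ n) (hN : 1 ≤ N) (hR : 0 < R) (hr : 0 < r)
    (hΦ : AnalyticOnNhd ℂ (fun p : (Fin n → ℂ) × E => Φ p.1 p.2)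
      (Metric.ball 0 (r + r) ×ˢ Metric.ball z (3 / 2 * R)))
    (hΦ0 : Φ 0 z = z)
    (hC : ∀ x ∈ Metric.ball (0 : Fin n → ℂ) (r + r), ∀ y ∈ Metric.ball z (3 / 2 * R),
      ‖Φ x y - y‖ ≤ C)
    (hρ0 : 0 ≤ ρ) (hρ : Real.exp 1 * ρ * n * Real.exp 1 / r ≤ 1 / 2)
    (hρN : 16 * C * (Real.exp 1 * ρ * n * Real.exp 1 / r) * N ≤ R)
    {x : Fin n → ℂ} (hx : ∀ l, ‖x l‖ ≤ ρ) :
    ∃ u, IsSolution (unitField (modCoeff fun α y => taylorCoeff (fun x => Φ x y) α) N x) 1 z u ∧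
      (∀ v, IsSolution (unitField (modCoeff fun α y => taylorCoeff (fun x => Φ x y) α) N x) 1 z v →
        Set.EqOn v u (Set.Icc 0 1)) ∧
      ‖u 1 - Φ x z‖ ≤ (R + C) * Real.exp (-(N + 1)) := by
  set T := Real.exp 1 with hT
  have hT1 : 1 ≤ T := Real.one_le_exp zero_le_one
  have hT0 : 0 < T := Real.exp_pos 1
  have hN0 : (0 : ℝ) < N := by exact_mod_cast hN
  have hN1 : (1 : ℝ) ≤ N := by exact_mod_cast hN
  have hn1 : (1 : ℝ) ≤ n := by exact_mod_cast hn
  have hzU : z ∈ Metric.ball z (3 / 2 * R) := Metric.mem_ball_self (by positivity)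
  have hC0 : 0 ≤ C := (norm_nonneg _).trans (hC 0 (Metric.mem_ball_self (by positivity)) z hzU)
  set c : (Fin n → ℕ) → E → E := fun α y => taylorCoeff (fun x => Φ x y) α with hc
  -- One shell of width `N σ = R/2` serves the recursion for the coefficients (from `3/2 R` to `R`),
  -- a second one the Lie derivatives along the solution (from `R` to `R/2`).
  set σ := R / (2 * N) with hσdef
  have hσ : 0 < σ := by positivity
  have hNσ : N * σ = R / 2 := by rw [hσdef]; field_simp
  have hσR : σ ≤ R / 2 := by rw [← hNσ]; nlinarith
  have hslice : ∀ y ∈ Metric.ball z (3 / 2 * R),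
      AnalyticOnNhd ℂ (fun x => Φ x y) (Metric.ball 0 (r + r)) := fun y hy x hx =>
    (hΦ (x, y) ⟨hx, hy⟩).comp_of_eq (f := fun x => (x, y)) (analyticAt_id.prod analyticAt_const) rfl
  have hca : ∀ α, AnalyticOnNhd ℂ (c α) (Metric.ball z (3 / 2 * R)) := fun α =>
    analyticOnNhd_taylorCoeff (Metric.isOpen_ball.prod Metric.isOpen_ball) hΦ
      (fun y hy => ⟨Metric.mem_ball_self (by positivity), hy⟩) α
  have hfa : ∀ α ∈ indexSet n N, AnalyticOnNhd ℂ (modCoeff c α) (Metric.ball z (3 / 2 * R)) :=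
    fun α hα => analyticOnNhd_modCoeff (fun α _ => hca α) α (mem_indexSet.1 hα).1
  set δ : (Fin n → ℕ) → ℝ := taylorBound C r with hδ
  have hδ0 : ∀ α, 0 ≤ δ α := fun α => by rw [hδ, taylorBound]; positivity
  set β := majCoeff δ σ with hβ
  have hβ0 : ∀ α, 0 ≤ β α := majCoeff_nonneg hσ hδ0
  have hrad : R + N * σ = 3 / 2 * R := by rw [hNσ]; ring
  have hfb : ∀ α ∈ indexSet n N, ∀ y ∈ Metric.ball z R, ‖modCoeff c α y‖ ≤ β α := by
    intro α hα y hy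
    refine norm_modCoeff_le (c := c) (z := z) (r := R) hσ hδ0 (by rw [hrad]; exact fun α _ => hca α)
      ?_ hα (Metric.ball_subset_ball (le_add_of_nonneg_right (by positivity)) hy)
    rw [hrad]
    exact fun α hα y hy =>
      norm_taylorCoeff_le_taylorBound hr (hslice y hy) (fun x hx => hC x hx y hy) hα
  -- For this `σ`, `hρN` is precisely the smallness `2 C θ ≤ σ/4` that the majorant recursion
  -- requires.
  have hS : ∑ α ∈ indexSet n N, (T * ρ) ^ deg α * β α ≤ σ / 2 := by
    refine sum_majCoeff_le hσ (by positivity) hδ0 ?_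
    refine (sum_taylorBound_le hC0 hr (by positivity) hρ).trans ?_
    rw [hσdef, div_div, le_div_iff₀ (by positivity)]
    linarith
  set F := unitField (modCoeff c) N x with hF
  have hFa : AnalyticOnNhd ℂ F (Metric.ball z (3 / 2 * R)) := fun y hy =>
    Finset.analyticAt_fun_sum _ fun α hα => AnalyticAt.fun_smul analyticAt_const (hfa α hα y hy)
  -- All degrees are at least one, so passing from weight `T * ρ` to `ρ` gains a factor `1/T`. The
  -- `(N + 1)`-fold Lie derivative collects it `N + 1` times.
  have hFb : ∀ y ∈ Metric.ball z R, ‖F y‖ ≤ σ / (2 * T) := by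
    intro y hy
    have h1 : ∀ α ∈ indexSet n N, ‖(∏ l, x l ^ α l) • modCoeff c α y‖ ≤
        T⁻¹ * ((T * ρ) ^ deg α * β α) := by
      intro α hα
      have h2 : ρ ^ deg α ≤ T⁻¹ * (T * ρ) ^ deg α := by
        rw [mul_pow, ← mul_assoc]
        refine le_mul_of_one_le_left (by positivity) ?_
        rw [inv_mul_eq_div, one_le_div hT0]
        exact le_self_pow₀ hT1 (by have := (mem_indexSet.1 hα).1; omega)
      rw [norm_smul, ← mul_assoc]
      exact mul_le_mul ((norm_prod_pow_le hx α).trans h2) (hfb α hα y hy) (norm_nonneg _)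
        (by positivity)
    refine (norm_sum_le _ _).trans ((Finset.sum_le_sum h1).trans ?_)
    rw [← Finset.mul_sum, inv_mul_le_iff₀ hT0]
    refine hS.trans_eq ?_
    field_simp
  have hR2 : R / 2 + R / 2 = R := by ring
  have hRU : Metric.ball z R ⊆ Metric.ball z (3 / 2 * R) := Metric.ball_subset_ball (by linarith)
  have hB : σ / (2 * T) ≤ R / 2 / 2 := by
    rw [div_le_iff₀ (by positivity)]
    nlinarith
  have hhalf : Metric.ball z (R / 2) ⊆ Metric.ball z R := Metric.ball_subset_ball (by linarith)
  obtain ⟨u, hu, huniq⟩ := exists_isSolution (F := F) (z := z) (r := R / 2) (by positivity) hB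
    (by rw [hR2]; exact hFa.differentiableOn.mono hRU) (by rw [hR2]; exact hFb)
  refine ⟨u, hu, huniq, ?_⟩
  have hmem : ∀ t ∈ Set.Icc (0 : ℝ) 1, u t ∈ Metric.ball z (R / 2) := fun t ht =>
    hu.mem_ball (by positivity) hB (fun y hy => hFb y (hhalf hy)) ht
  have hlie : ∀ t ∈ Set.Icc (0 : ℝ) 1,
      ‖iterD (List.replicate (N + 1) F) (u t)‖ ≤ σ / T ^ (N + 1) := by
    intro t ht
    have hrad2 : R / 2 + (N + 1 - 1 : ℕ) * σ = R := by
      rw [Nat.add_sub_cancel, hNσ]; ring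
    have h := norm_iterD_ofFn_le (f := fun _ : Unit => F) (b := fun _ => σ / (2 * T)) hσ
      (i := N + 1) (by omega) (fun _ => ()) (z := z) (ρ := R / 2) (fun _ => by positivity)
      (by rw [hrad2]; exact fun _ => hFa.mono hRU) (by rw [hrad2]; exact fun _ => hFb) (hmem t ht)
    rw [List.ofFn_const, Finset.prod_const, Finset.card_univ, Fintype.card_fin,
      Nat.add_sub_cancel] at h
    refine h.trans ?_
    rw [div_pow, div_div, div_le_div_iff₀ (by positivity) (by positivity), mul_pow]
    have h2 : (1 : ℝ) ≤ 2 ^ (N + 1) := one_le_pow₀ (by norm_num)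
    calc σ ^ (N + 1) * T ^ (N + 1) = 1 * (σ ^ (N + 1) * T ^ (N + 1)) := (one_mul _).symm
      _ ≤ 2 ^ (N + 1) * (σ ^ (N + 1) * T ^ (N + 1)) := by gcongr
      _ = σ * (2 ^ (N + 1) * T ^ (N + 1) * σ ^ N) := by ring
  have h1 := hu.norm_sub_lieSeries_le (U := Metric.ball z R) (N := N) (hFa.mono hRU)
    (fun t ht => hhalf (hmem t ht)) hlie
  have h1' : σ / T ^ (N + 1) / N ! ≤ σ / T ^ (N + 1) :=
    div_le_self (by positivity) (by exact_mod_cast Nat.one_le_iff_ne_zero.2 (Nat.factorial_ne_zero N))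
  have hNsub : Metric.ball z (N * σ) ⊆ Metric.ball z R := by rw [hNσ]; exact hhalf
  have h2 := norm_lieSeries_sub_le (c := c) (z := z) hN hσ hρ0 hT1 hx hβ0
    (fun α hα => (hfa α hα).mono (hNsub.trans hRU)) (fun α hα y hy => hfb α hα y (hNsub hy)) hS
  have hρr : 2 * T * ρ / r ≤ T⁻¹ := by
    rw [inv_eq_one_div, div_le_div_iff₀ hr hT0]
    rw [div_le_iff₀ hr] at hρ
    have h3 : T * ρ * T ≤ T * ρ * n * T := by
      calc T * ρ * T = T * ρ * 1 * T := by ring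
        _ ≤ T * ρ * n * T := by gcongr
    linarith
  have hρlt : ρ < r := by
    rw [div_le_iff₀ hr] at hρr
    have h4 : T⁻¹ * r ≤ 1 * r := by gcongr; exact inv_le_one_of_one_le₀ hT1
    nlinarith
  have h3 := norm_sub_sum_taylorCoeff_le (a := z) (C := C) hr (hslice z hzU)
    (fun x hx => hC x hx z hzU) hρ0 hρlt hx N
  have h3' : C * (2 * T * ρ / r) ^ (N + 1) ≤ C / T ^ (N + 1) := by
    rw [div_eq_mul_inv C, ← inv_pow]
    gcongr
  rw [hΦ0] at h3
  have hexp : Real.exp (-(N + 1)) = (T ^ (N + 1))⁻¹ := by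
    rw [hT, Real.exp_neg, ← Real.exp_nat_mul]
    push_cast
    rw [mul_one]
  set A := ∑ i ∈ Finset.Icc 1 N, (i ! : ℂ)⁻¹ • iterD (List.replicate i F) z with hA
  set D := ∑ α ∈ indexSet n N, (∏ l, x l ^ α l) • c α z with hD
  have h2' : ‖A - D‖ ≤ σ / T ^ (N + 1) := h2
  have h3'' : ‖Φ x z - (z + D)‖ ≤ C / T ^ (N + 1) := h3.trans h3'
  -- `A` is the truncated Lie series of the flow, `D` the truncated expansion of the method.
  have hsplit : u 1 - Φ x z = (u 1 - (z + A)) + (A - D) - (Φ x z - (z + D)) := by abel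
  rw [hsplit, hexp, ← div_eq_mul_inv]
  calc ‖(u 1 - (z + A)) + (A - D) - (Φ x z - (z + D))‖
      ≤ ‖u 1 - (z + A)‖ + ‖A - D‖ + ‖Φ x z - (z + D)‖ :=
        (norm_sub_le _ _).trans (add_le_add_left (norm_add_le _ _) _)
    _ ≤ σ / T ^ (N + 1) + σ / T ^ (N + 1) + C / T ^ (N + 1) :=
        add_le_add (add_le_add (h1.trans h1') h2') h3''
    _ ≤ R / 2 / T ^ (N + 1) + R / 2 / T ^ (N + 1) + C / T ^ (N + 1) := by gcongr
    _ = (R + C) / T ^ (N + 1) := by ring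

/-- The deterministic core: one step of a Runge–Kutta method with small increments. -/
theorem BoundedFields.exists_isTruncModSolution {d s N : ℕ} {a : Fin s → Fin s → ℝ}
    {V : Fin (d + 1) → E → E} {z : E} {R M κ : ℝ} (H : BoundedFields a V z R M κ)
    {b : Fin s → ℝ} {μ r ρ h : ℝ} (hμ : ∑ i, |b i| ≤ μ) (hN : 1 ≤ N) (hr : 0 < r) (hκ : 0 < κ)
    (hM : 0 < M) (hrκ : κ * ((d + 1 : ℕ) * (r + r) * M) ≤ R / 8) (hρ0 : 0 ≤ ρ)
    (hρ : Real.exp 1 * ρ * (d + 1 : ℕ) * Real.exp 1 / r ≤ 1 / 2)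
    (hρN : 16 * (μ * ((d + 1 : ℕ) * (r + r) * M)) *
      (Real.exp 1 * ρ * (d + 1 : ℕ) * Real.exp 1 / r) * N ≤ R)
    (hh : 0 < h) {Δ : Fin d → ℝ} (hx : ∀ l, ‖incrVec h Δ l‖ ≤ ρ) :
    ∃ u, IsTruncModSolution a b V (Metric.closedBall z (2 * R)) N h Δ z u ∧
      (∀ v, IsTruncModSolution a b V (Metric.closedBall z (2 * R)) N h Δ z v →
        Set.EqOn v u (Set.Icc 0 h)) ∧
      ‖u h - rkStep a b V (Metric.closedBall z (2 * R)) (incrVec h Δ) z‖ ≤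
        (R + μ * ((d + 1 : ℕ) * (r + r) * M)) * Real.exp (-(N + 1)) := by
  set S := Metric.closedBall z (2 * R) with hS
  have hμ0 : 0 ≤ μ := (Finset.sum_nonneg fun _ _ => abs_nonneg _).trans hμ
  have hsmall : ∀ x ∈ Metric.ball (0 : Fin (d + 1) → ℂ) (r + r),
      κ * ((d + 1 : ℕ) * ‖x‖ * M) < R / 8 := by
    intro x hx
    rw [mem_ball_zero_iff] at hx
    refine lt_of_lt_of_le ?_ hrκ
    gcongr
  obtain ⟨w, hw, hwu, hwb⟩ := exists_unitField_isSolution (Φ := fun x y => rkStep a b V S x y)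
    (C := μ * ((d + 1 : ℕ) * (r + r) * M)) (Nat.le_add_left 1 d) hN H.radius_pos hr
    (fun p hp => H.analyticAt_rkStep b (hsmall _ hp.1) hp.2) (rkStep_zero a b V S z)
    (fun x hx y hy => (H.norm_rkStep_sub_le hμ (hsmall x hx).le hy).trans (by
      rw [mem_ball_zero_iff] at hx
      gcongr)) hρ0 hρ hρN hx
  have hfield : ∀ y, unitField (modCoeff (rkCoeff a b V S)) N (incrVec h Δ) y =
      h • truncField (modCoeff (rkCoeff a b V S)) N h Δ y := by
    intro y
    rw [← smul_truncField _ _ hh.ne']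
    exact algebraMap_smul ℂ h _
  have hfield' : ∀ y, truncField (modCoeff (rkCoeff a b V S)) N h Δ y =
      h⁻¹ • unitField (modCoeff (rkCoeff a b V S)) N (incrVec h Δ) y := fun y => by
    rw [hfield, inv_smul_smul₀ hh.ne']
  have hw' : IsSolution (unitField (modCoeff (rkCoeff a b V S)) N (incrVec h Δ)) (h⁻¹ * h) z w := by
    rw [inv_mul_cancel₀ hh.ne']
    exact hw
  refine ⟨fun t => w (h⁻¹ * t), hw'.comp_mul (inv_pos.2 hh) hfield', fun v hv t ht => ?_, ?_⟩
  · have hv' : IsSolution (truncField (modCoeff (rkCoeff a b V S)) N h Δ) (h * 1) z v := by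
      rw [mul_one]
      exact hv
    have hmem : h⁻¹ * t ∈ Set.Icc (0 : ℝ) 1 :=
      ⟨mul_nonneg (inv_pos.2 hh).le ht.1, by rw [inv_mul_le_iff₀ hh, mul_one]; exact ht.2⟩
    have := hwu _ (hv'.comp_mul hh hfield) hmem
    simpa [mul_inv_cancel_left₀ hh.ne'] using this
  · simpa [inv_mul_cancel₀ hh.ne'] using hwb

end

/-! ### Truncated increments and the choice of constants -/

theorem abs_truncate_le {A : ℝ} (hA : 0 ≤ A) (ξ : ℝ) : |truncate A ξ| ≤ A := by
  unfold truncate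
  split_ifs with h1 h2
  · exact h1
  · exact (abs_of_nonneg hA).le
  · rw [abs_neg, abs_of_nonneg hA]

theorem norm_incrVec_le {d : ℕ} {h k ρ : ℝ} (hh : 0 < h) (hρ : h ≤ ρ)
    (hk : threshold k h * √h ≤ ρ) (ξ : Fin d → ℝ) (l : Fin (d + 1)) :
    ‖incrVec h (fun l => truncIncrement k h (ξ l)) l‖ ≤ ρ := by
  refine Fin.cases ?_ (fun l => ?_) l
  · simpa [incrVec, abs_of_pos hh] using hρ
  · simp only [incrVec, Fin.cons_succ, Complex.norm_real, Real.norm_eq_abs, truncIncrement, abs_mul,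
      abs_of_nonneg (Real.sqrt_nonneg h)]
    exact (mul_le_mul_of_nonneg_right (abs_truncate_le (Real.sqrt_nonneg _) _)
      (Real.sqrt_nonneg _)).trans hk

open Filter Topology in
/-- For small step sizes `h`, the power `h ^ (1/2 - ε/2)` dominates all truncated increments, and
`exp (-c / h ^ (1/2 - ε/2))` is smaller than the required error bound. -/
theorem eventually_small_step {ε c H k : ℝ} (hε : 0 < ε) (hε' : ε < 1 / 2) (hc : 0 < c)
    (hk : 0 < k) :
    ∀ᶠ h : ℝ in 𝓝[>] 0, h ≤ h ^ (1 / 2 - ε / 2) ∧ h ^ (1 / 2 - ε / 2) ≤ c ∧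
      threshold k h * √h ≤ h ^ (1 / 2 - ε / 2) ∧
      Real.exp (-(c / h ^ (1 / 2 - ε / 2))) ≤ h * Real.exp (-(H / h ^ (1 / 2 - ε))) := by
  have hzero : ∀ {p : ℝ}, 0 < p → Tendsto (fun h : ℝ => h ^ p) (𝓝[>] 0) (𝓝 0) := by
    intro p hp
    have := (Real.continuousAt_rpow_const 0 p (Or.inr hp.le)).tendsto
    rw [Real.zero_rpow hp.ne'] at this
    exact this.mono_left nhdsWithin_le_nhds
  have h1 : ∀ᶠ h : ℝ in 𝓝[>] 0, h ^ (1 / 2 - ε / 2) ≤ c :=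
    (hzero (by linarith)).eventually_le_const hc
  have h2 : ∀ᶠ h : ℝ in 𝓝[>] 0, H * h ^ (ε / 2) ≤ c / 2 := by
    have := (hzero (p := ε / 2) (by linarith)).const_mul H
    rw [mul_zero] at this
    exact this.eventually_le_const (by positivity)
  have h3 := (isLittleO_log_rpow_nhdsGT_zero (r := -ε) (by linarith)).bound
    (c := k⁻¹) (by positivity)
  have h4 := (isLittleO_log_rpow_nhdsGT_zero (r := -(1 / 2 - ε / 2)) (by linarith)).bound
    (c := c / 2) (by positivity)
  filter_upwards [h1, h2, h3, h4, Ioo_mem_nhdsGT (zero_lt_one (α := ℝ))] with h h1 h2 h3 h4 hh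
  obtain ⟨hh0, hh1⟩ := hh
  rw [Real.norm_eq_abs, Real.norm_of_nonneg (Real.rpow_nonneg hh0.le _)] at h3 h4
  refine ⟨?_, h1, ?_, ?_⟩
  · exact Real.self_le_rpow_of_le_one hh0.le hh1.le (by linarith)
  -- The threshold grows only logarithmically, so `A_h √h ≤ h^{1/2 - ε/2}`.
  · have h5 : k * |Real.log h| ≤ h ^ (-ε) := by
      rwa [← div_eq_inv_mul, le_div_iff₀' hk] at h3
    rw [threshold, ← Real.sqrt_mul (by positivity)]
    refine Real.sqrt_le_iff.2 ⟨by positivity, ?_⟩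
    calc k * |Real.log h| * h ≤ h ^ (-ε) * h := by gcongr
      _ = h ^ (-ε + 1) := by rw [Real.rpow_add_one hh0.ne']
      _ = (h ^ (1 / 2 - ε / 2)) ^ 2 := by
        rw [← Real.rpow_natCast, ← Real.rpow_mul hh0.le]
        congr 1
        push_cast
        ring
  · rw [← Real.exp_log hh0, ← Real.exp_add, Real.exp_log hh0]
    refine Real.exp_le_exp.2 ?_
    rw [div_eq_mul_inv c, div_eq_mul_inv H, ← Real.rpow_neg hh0.le, ← Real.rpow_neg hh0.le]
    -- Half of `c / ρ` absorbs the term with `H`, since `H h^{ε/2} ≤ c/2`; the other half absorbs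
    -- `|log h|`, that is, the factor `h`.
    have h6 : h ^ (-(1 / 2 - ε)) = h ^ (ε / 2) * h ^ (-(1 / 2 - ε / 2)) := by
      rw [← Real.rpow_add hh0]
      congr 1
      ring
    have h7 := (abs_le.1 h4).1
    have h8 : 0 ≤ h ^ (-(1 / 2 - ε / 2)) := Real.rpow_nonneg hh0.le _
    rw [h6]
    nlinarith [mul_le_mul_of_nonneg_right h2 h8]

end StochModEq

theorem theorem4p5 (d s : ℕ) (a : Fin s → Fin s → ℝ) (b : Fin s → ℝ)
    (R M ε k : ℝ) (hR : 0 < R) (hε : 0 < ε) (hε' : ε < 1 / 2) (hk : 0 < k) :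
    ∃ C hmax : ℝ, 0 < C ∧ 0 < hmax ∧ ∀ h : ℝ, 0 < h → h < hmax → ∃ N : ℕ, 1 ≤ N ∧
      ∀ (m : ℕ) (z : EuclideanSpace ℂ (Fin m))
        (V : Fin (d + 1) → EuclideanSpace ℂ (Fin m) → EuclideanSpace ℂ (Fin m)),
        (∀ l, AnalyticOnNhd ℂ (V l) (Metric.closedBall z (2 * R))) →
        (∀ l, ∀ y ∈ Metric.closedBall z (2 * R), ‖V l y‖ ≤ M) →
        ∀ (Ω : Type*) [MeasurableSpace Ω] (P : Measure Ω) [IsProbabilityMeasure P]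
          (ξ : Fin d → Ω → ℝ),
          (∀ l, HasLaw (ξ l) (gaussianReal 0 1) P) → iIndepFun ξ P →
          ∀ ω : Ω,
            (∃! g : Fin s → EuclideanSpace ℂ (Fin m),
              StochModEq.IsRKStages a V (Metric.closedBall z (2 * R))
                (StochModEq.incrVec h (StochModEq.truncIncrements k h ξ ω)) z g) ∧
            ∃ u : ℝ → EuclideanSpace ℂ (Fin m),
              StochModEq.IsTruncModSolution a b V (Metric.closedBall z (2 * R)) N h
                (StochModEq.truncIncrements k h ξ ω) z u ∧
              (∀ v : ℝ → EuclideanSpace ℂ (Fin m),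
                StochModEq.IsTruncModSolution a b V (Metric.closedBall z (2 * R)) N h
                  (StochModEq.truncIncrements k h ξ ω) z v → Set.EqOn v u (Set.Icc 0 h)) ∧
              ‖u h - StochModEq.rkStep a b V (Metric.closedBall z (2 * R))
                  (StochModEq.incrVec h (StochModEq.truncIncrements k h ξ ω)) z‖ ≤
                C * h * Real.exp (-(StochModEq.hZero d a b R M / h ^ (1 / 2 - ε))) := by
  -- `M'` and `κ` are enlarged to be strictly positive, so that the radius `r` below is well defined
  -- even if `M ≤ 0` or the matrix vanishes. The sharp values enter only through `hZero`.
  set M' := |M| + 1 with hM'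
  set κ := ∑ i, ∑ j, |a i j| + 1 with hκ
  set μ := ∑ i, |b i| with hμ
  have hM'0 : 0 < M' := by positivity
  have hκ0 : 0 < κ := by positivity
  have hμ0 : 0 ≤ μ := by positivity
  set r := R / (16 * κ * (d + 1 : ℕ) * M') with hr
  have hr0 : 0 < r := by positivity
  have hrκ : κ * ((d + 1 : ℕ) * (r + r) * M') ≤ R / 8 := by
    refine le_of_eq ?_
    rw [hr]
    field_simp
    norm_num
  set C₀ := μ * ((d + 1 : ℕ) * (r + r) * M') with hC₀
  have hC₀0 : 0 ≤ C₀ := by positivity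
  set Q := Real.exp 1 * (d + 1 : ℕ) * Real.exp 1 / r with hQ
  have hQ0 : 0 < Q := by positivity
  -- The first entry makes the geometric series converge with ratio `Q ρ ≤ 1/2`; the second gives
  -- `16 C₀ Q ρ N ≤ R` once `N ρ ≤ c`. The `+ 1` guards against `C₀ = 0`.
  set c := min (1 / (2 * Q)) (R / (16 * (C₀ + 1) * Q)) with hc
  have hc0 : 0 < c := by positivity
  obtain ⟨hmax, hmax0, hsmall⟩ := (mem_nhdsGT_iff_exists_Ioo_subset).1
    (StochModEq.eventually_small_step (H := StochModEq.hZero d a b R M) hε hε' hc0 hk)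
  refine ⟨R + C₀, hmax, by positivity, hmax0, fun h hh0 hh1 => ?_⟩
  obtain ⟨h1, h2, h3, h4⟩ := hsmall ⟨hh0, hh1⟩
  set ρ := h ^ (1 / 2 - ε / 2) with hρ
  have hρ0 : 0 < ρ := Real.rpow_pos_of_pos hh0 _
  have hN : 1 ≤ ⌊c / ρ⌋₊ := Nat.le_floor (by rw [Nat.cast_one, one_le_div hρ0]; exact h2)
  have hNρ : (⌊c / ρ⌋₊ : ℝ) * ρ ≤ c := by
    rw [← le_div_iff₀ hρ0]
    exact Nat.floor_le (by positivity)
  refine ⟨⌊c / ρ⌋₊, hN, fun m z V hV hVM Ω _ P _ ξ _ _ ω => ?_⟩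
  have hx : ∀ l, ‖StochModEq.incrVec h (StochModEq.truncIncrements k h ξ ω) l‖ ≤ ρ :=
    StochModEq.norm_incrVec_le hh0 h1 h3 fun l => ξ l ω
  have H : StochModEq.BoundedFields a V z R M' κ :=
    { radius_pos := hR
      bound_nonneg := hM'0.le
      rowSum_nonneg := hκ0.le
      rowSum_le := fun i => (Finset.single_le_sum (f := fun i => ∑ j, |a i j|)
        (fun _ _ => by positivity) (Finset.mem_univ i)).trans (by linarith)
      analytic := hV
      norm_le := fun l y hy => (hVM l y hy).trans (by linarith [le_abs_self M]) }
  have hQρ : Real.exp 1 * ρ * (d + 1 : ℕ) * Real.exp 1 / r = Q * ρ := by rw [hQ]; ring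
  have hQc : Q * c ≤ 1 / 2 := by
    calc Q * c ≤ Q * (1 / (2 * Q)) := by gcongr; exact min_le_left _ _
      _ = 1 / 2 := by field_simp
  have hCc : 16 * (C₀ + 1) * Q * c ≤ R := by
    calc 16 * (C₀ + 1) * Q * c ≤ 16 * (C₀ + 1) * Q * (R / (16 * (C₀ + 1) * Q)) := by
          gcongr; exact min_le_right _ _
      _ = R := by field_simp
  have hQρ2 : Q * ρ ≤ 1 / 2 := (mul_le_mul_of_nonneg_left h2 hQ0.le).trans hQc
  have hxr : ‖StochModEq.incrVec h (StochModEq.truncIncrements k h ξ ω)‖ ≤ r + r := by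
    refine ((pi_norm_le_iff_of_nonneg hρ0.le).2 hx).trans ?_
    rw [hQ, div_mul_eq_mul_div, div_le_iff₀ hr0] at hQρ2
    have he : 1 ≤ Real.exp 1 := Real.one_le_exp zero_le_one
    have hd : (1 : ℝ) ≤ (d + 1 : ℕ) := by exact_mod_cast Nat.le_add_left 1 d
    have : 1 ≤ Real.exp 1 * (d + 1 : ℕ) * Real.exp 1 :=
      one_le_mul_of_one_le_of_one_le (one_le_mul_of_one_le_of_one_le he hd) he
    nlinarith
  refine ⟨H.existsUnique_isRKStages (le_trans (by gcongr) hrκ)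
    (Metric.mem_ball_self (by positivity)), ?_⟩
  obtain ⟨u, hu, huu, hub⟩ := H.exists_isTruncModSolution (N := ⌊c / ρ⌋₊) (b := b) (μ := μ) le_rfl hN
    hr0 hκ0 hM'0 hrκ hρ0.le (by rw [hQρ]; exact hQρ2) (by
      rw [hQρ]
      calc 16 * C₀ * (Q * ρ) * ⌊c / ρ⌋₊ = 16 * C₀ * Q * (⌊c / ρ⌋₊ * ρ) := by ring
        _ ≤ 16 * (C₀ + 1) * Q * c := by gcongr; linarith
        _ ≤ R := hCc) hh0 hx
  refine ⟨u, hu, huu, hub.trans ?_⟩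
  rw [mul_assoc (R + C₀)]
  refine mul_le_mul_of_nonneg_left (le_trans (Real.exp_le_exp.2 ?_) h4) (by positivity)
  -- Rounding down costs nothing: the exponent is `N + 1`, which exceeds `c / ρ`.
  linarith [Nat.lt_floor_add_one (c / ρ)]
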